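/- Theorem. For every even integer $k \ge 6$ there is an infinite family of pairwise non-isomorphic finite simple graphs $G$ such that $G$ is $3$-connected, cubic and planar, the circumference of $G$ (the length of a longest cycle of $G$) is at least $k$, and $G$ contains no cycle whose length lies in the interval $[k, 2k+2]$. Consequently, for every even integer $k \ge 6$, the conjecture of Merker that every $3$-connected cubic planar graph of circumference at least $k$ contains a cycle whose length lies in $[k, 2k+2]$ is false. -/

import Mathlib

/-- A graph is 3-connected if it has more than three vertices and it stays connected after
deleting any set of fewer than three vertices. -/
def IsThreeConnected {V : Type*} [Fintype V] (G : SimpleGraph V) : Prop :=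
  3 < Fintype.card V ∧
    ∀ S : Finset V, S.card < 3 → (G.induce ((S : Set V)ᶜ)).Connected

open Classical in
/-- A finite graph is cubic if every vertex has degree three. -/
def IsCubic {V : Type*} [Fintype V] (G : SimpleGraph V) : Prop :=
  G.IsRegularOfDegree 3

/-- `A` is a simple arc in the plane with endpoints `x` and `y`: the image of an injective
continuous path from `x` to `y`. -/
def IsArcBetween (x y : ℝ × ℝ) (A : Set (ℝ × ℝ)) : Prop :=
  ∃ γ : Path x y, Function.Injective γ ∧ Set.range γ = A

/-- A plane embedding (drawing without crossings) of `G`: the vertices are distinct points of the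
plane, every edge is a simple arc joining its two ends, an arc contains no vertex other than its
ends, and two distinct arcs meet at most in common ends. The value of `arc` at a pair that is not
an edge is irrelevant. -/
structure PlaneEmbedding {V : Type*} (G : SimpleGraph V) where
  point : V → ℝ × ℝ
  arc : Sym2 V → Set (ℝ × ℝ)
  point_injective : Function.Injective point
  isArc : ∀ u v, G.Adj u v → IsArcBetween (point u) (point v) (arc s(u, v))
  mem_of_point_mem : ∀ e ∈ G.edgeSet, ∀ w, point w ∈ arc e → w ∈ e
  arc_inter : ∀ e ∈ G.edgeSet, ∀ f ∈ G.edgeSet, e ≠ f →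
    arc e ∩ arc f ⊆ point '' {v | v ∈ e ∧ v ∈ f}

/-- A graph is planar if it has a plane embedding. -/
def IsPlanar {V : Type*} (G : SimpleGraph V) : Prop :=
  Nonempty (PlaneEmbedding G)

/-- The set of lengths of cycles of `G`. -/
def cycleSpectrum {V : Type*} (G : SimpleGraph V) : Set ℕ :=
  {l | ∃ (v : V) (c : G.Walk v v), c.IsCycle ∧ c.length = l}

/-- The circumference: the supremum (for a finite graph with a cycle, the maximum) of the cycle
lengths of `G`; it is `0` if `G` has no cycle. -/
noncomputable def circumference {V : Type*} (G : SimpleGraph V) : ℕ∞ :=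
  ⨆ l ∈ cycleSpectrum G, (l : ℕ∞)

/-- Merker's conjecture for the integer `k`: every 3-connected cubic planar graph of circumference
at least `k` has a cycle whose length lies in `[k, 2k+2]`. -/
def MerkerConjecture (k : ℕ) : Prop :=
  ∀ (V : Type) [Fintype V] (G : SimpleGraph V),
    IsThreeConnected G → IsCubic G → IsPlanar G → (k : ℕ∞) ≤ circumference G →
      (cycleSpectrum G ∩ Set.Icc k (2 * k + 2)).Nonempty

/-! Write k = 2p + 4 with p ≥ 1. Every vertex of a large cubic planar base graph is blown up into a
cluster of k - 1 = 2p + 3 vertices by p + 1 truncations, each replacing a vertex by a triangle. A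
cycle inside one cluster has at most k - 1 vertices, so the whole point is to force every other
cycle to have at least 2k + 3 = 4p + 11 vertices. Truncation keeps a graph cubic, 3-connected
(`isThreeConnected_truncGraph`) and drawable with straight edges
(`IsStraightDrawing.exists_truncGraph`).

The cost of passing through a cluster is encoded by weights on half-edges: the two weights used at a
vertex add up to twice a lower bound for the number of cluster vertices on the passage. Repeated
truncation at the corner facing one port raises the bound for every passage through that port by one
each time. Contracting the new triangle sends a subgraph with even degrees to one with even degrees
and does not increase the weight (`contract_corner_aux`, `heavy_trunc`). Hence a weight bound for
even subgraphs of the base survives all truncations (`TruncationPlan.trunc`,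
`TruncationPlan.exists_complete`); at the end the weight of a cycle is twice its length
(`TruncationPlan.cycle_length`).

The base is a tube of five concentric rings joined by radial edges, the radial port being the
expensive one. By `heavy_tubeGraph` a nonempty even subgraph has weight at least 8p + 22 = 2(4p +
11). Without radial edges it contains a whole ring, of weight at least 4n. With three or more radial
edges it weighs at least 12p + 18, which suffices as p ≥ 1. By parity it cannot have exactly one.
With exactly two, it must pass between them on both sides, and an inspection of the neighbourhood,
with pentagonal and hexagonal faces as the tight cases, gives the bound.

An edge between clusters is not a bridge, so a long cycle exists and the circumference is large.
Letting n grow gives arbitrarily large counterexamples. -/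

/-- `a` and `b` lie outside `S` and are joined by a walk of `G` that avoids `S`. -/
def Linked {V : Type*} (G : SimpleGraph V) (S : Finset V) (a b : V) : Prop :=
  ∃ (ha : a ∈ ((S : Set V)ᶜ)) (hb : b ∈ ((S : Set V)ᶜ)),
    (G.induce ((S : Set V)ᶜ)).Reachable ⟨a, ha⟩ ⟨b, hb⟩

namespace Linked

variable {V : Type*} {G : SimpleGraph V} {S : Finset V} {a b c : V}

theorem refl (ha : a ∉ S) : Linked G S a a :=
  ⟨by simpa using ha, by simpa using ha, SimpleGraph.Reachable.refl _⟩

theorem symm (h : Linked G S a b) : Linked G S b a := by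
  obtain ⟨ha, hb, h⟩ := h
  exact ⟨hb, ha, h.symm⟩

theorem trans (h : Linked G S a b) (h' : Linked G S b c) : Linked G S a c := by
  obtain ⟨ha, hb, h⟩ := h
  obtain ⟨_, hc, h'⟩ := h'
  exact ⟨ha, hc, h.trans h'⟩

theorem of_adj (hab : G.Adj a b) (ha : a ∉ S) (hb : b ∉ S) : Linked G S a b :=
  ⟨by simpa using ha, by simpa using hb,
    SimpleGraph.Adj.reachable (by simpa [SimpleGraph.comap_adj] using hab)⟩

theorem notMem_left (h : Linked G S a b) : a ∉ S := by
  obtain ⟨ha, _⟩ := h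
  simpa using ha

theorem notMem_right (h : Linked G S a b) : b ∉ S := h.symm.notMem_left

theorem connected (hb : b ∉ S) (h : ∀ a, a ∉ S → Linked G S a b) :
    (G.induce ((S : Set V)ᶜ)).Connected := by
  have : Nonempty ((S : Set V)ᶜ : Set V) := ⟨⟨b, by simpa using hb⟩⟩
  refine SimpleGraph.Connected.mk ?_
  rintro ⟨x, hx⟩ ⟨z, hz⟩
  obtain ⟨_, _, h1⟩ := h x (by simpa using hx)
  obtain ⟨_, _, h2⟩ := h z (by simpa using hz)
  exact h1.trans h2.symm

theorem of_connected (h : (G.induce ((S : Set V)ᶜ)).Connected) (ha : a ∉ S) (hb : b ∉ S) :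
    Linked G S a b :=
  ⟨by simpa using ha, by simpa using hb, h.preconnected _ _⟩

/-- A relation that is transitive on linked vertices and holds along edges holds for linked
vertices. -/
theorem induction {P : V → V → Prop} (hrefl : ∀ a, a ∉ S → P a a)
    (hstep : ∀ a b c, a ∉ S → b ∉ S → G.Adj a b → P b c → P a c) (h : Linked G S a b) :
    P a b := by
  obtain ⟨ha, hb, ⟨p⟩⟩ := h
  suffices ∀ (x z : ((S : Set V)ᶜ : Set V)), (G.induce ((S : Set V)ᶜ)).Walk x z → P x z from
    this _ _ p
  intro x z p
  induction p with
  | @nil u => exact hrefl _ fun h => u.2 (Finset.mem_coe.2 h)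
  | @cons u v w hadj _ ih =>
    exact hstep u v w (fun h => u.2 (Finset.mem_coe.2 h))
      (fun h => v.2 (Finset.mem_coe.2 h)) (by simpa using hadj) ih

end Linked

/-! ### Cubic vertices, truncation and 3-connectedness. -/

/-- The vertex `v` has exactly the three neighbours `w 0`, `w 1`, `w 2`. -/
structure HasNeighbors {V : Type*} (G : SimpleGraph V) (v : V) (w : Fin 3 → V) : Prop where
  inj : Function.Injective w
  adj_iff : ∀ x, G.Adj v x ↔ ∃ i, w i = x

namespace HasNeighbors

variable {V : Type*} {G : SimpleGraph V} {v : V} {w : Fin 3 → V}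

theorem adj (h : HasNeighbors G v w) (i : Fin 3) : G.Adj v (w i) := (h.adj_iff _).2 ⟨i, rfl⟩

theorem ne (h : HasNeighbors G v w) (i : Fin 3) : w i ≠ v := (h.adj i).ne'

open Classical in
theorem sum_ite [Fintype V] {M : Type*} [AddCommMonoid M] (h : HasNeighbors G v w)
    {C : SimpleGraph V} (hC : C ≤ G) (g : V → M) :
    (∑ x, if C.Adj v x then g x else 0) = ∑ i, if C.Adj v (w i) then g (w i) else 0 := by
  rw [← Finset.sum_image (s := Finset.univ) (g := w) (f := fun x => if C.Adj v x then g x else 0)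
    (fun a _ b _ hab => h.inj hab)]
  symm
  refine Finset.sum_subset (Finset.subset_univ _) ?_
  intro x _ hx
  rw [if_neg]
  intro hvx
  obtain ⟨i, rfl⟩ := (h.adj_iff x).1 (hC hvx)
  exact hx (Finset.mem_image_of_mem _ (Finset.mem_univ i))

end HasNeighbors

theorem isCubic_of_hasNeighbors {V : Type*} [Fintype V] {G : SimpleGraph V}
    (h : ∀ v, ∃ w, HasNeighbors G v w) : IsCubic G := by
  classical
  intro v
  obtain ⟨w, hw⟩ := h v
  have : G.neighborFinset v = Finset.univ.image w := by
    ext x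
    simp [hw.adj_iff]
  rw [← SimpleGraph.card_neighborFinset_eq_degree]
  convert (congrArg Finset.card this).trans (Finset.card_image_of_injective _ hw.inj) using 1
  simp

/-- The graph obtained from `G` by replacing `v` by a triangle whose corners are attached to
`w 0`, `w 1`, `w 2`. -/
def truncGraph {V : Type*} (G : SimpleGraph V) (v : V) (w : Fin 3 → V) :
    SimpleGraph ({x // x ≠ v} ⊕ Fin 3) where
  Adj
    | .inl x, .inl z => G.Adj x z
    | .inl x, .inr i => w i = x
    | .inr i, .inl x => w i = x
    | .inr i, .inr j => i ≠ j
  symm := ⟨by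
    rintro (x | i) (z | j) h
    · exact G.adj_symm h
    · exact h
    · exact h
    · exact Ne.symm h⟩
  loopless := ⟨by
    rintro (x | i) h
    · exact G.loopless.irrefl _ h
    · exact h rfl⟩

/-- The map contracting the new triangle back to `v`. -/
def truncProj {V : Type*} (v : V) : {x // x ≠ v} ⊕ Fin 3 → V := Sum.elim (↑) fun _ => v

section Trunc

variable {V : Type*} {G : SimpleGraph V} {v : V} {w : Fin 3 → V}

@[simp] theorem truncProj_inl (x : {x // x ≠ v}) : truncProj v (.inl x) = x := rfl
@[simp] theorem truncProj_inr (i : Fin 3) : truncProj v (.inr i) = v := rfl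

theorem truncProj_surjective (v : V) : Function.Surjective (truncProj v) := by
  intro x
  by_cases hx : x = v
  · exact ⟨.inr 0, hx.symm⟩
  · exact ⟨.inl ⟨x, hx⟩, rfl⟩

@[simp] theorem truncGraph_inl_inl (x z : {x // x ≠ v}) :
    (truncGraph G v w).Adj (.inl x) (.inl z) ↔ G.Adj x z := Iff.rfl
@[simp] theorem truncGraph_inl_inr (x : {x // x ≠ v}) (i : Fin 3) :
    (truncGraph G v w).Adj (.inl x) (.inr i) ↔ w i = x := Iff.rfl
@[simp] theorem truncGraph_inr_inl (x : {x // x ≠ v}) (i : Fin 3) :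
    (truncGraph G v w).Adj (.inr i) (.inl x) ↔ w i = x := Iff.rfl
@[simp] theorem truncGraph_inr_inr (i j : Fin 3) :
    (truncGraph G v w).Adj (.inr i) (.inr j) ↔ i ≠ j := Iff.rfl

/-- The neighbours of the corner `i` of the new triangle. -/
def cornerNeighbors (hw : HasNeighbors G v w) (i : Fin 3) : Fin 3 → {x // x ≠ v} ⊕ Fin 3 :=
  ![.inl ⟨w i, hw.ne i⟩, .inr (i + 1), .inr (i + 2)]

theorem hasNeighbors_corner (hw : HasNeighbors G v w) (i : Fin 3) :
    HasNeighbors (truncGraph G v w) (.inr i) (cornerNeighbors hw i) where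
  inj := by
    intro a b
    fin_cases a <;> fin_cases b <;> simp [cornerNeighbors]
  adj_iff := by
    rintro (x | j)
    · simp [Fin.exists_fin_succ, cornerNeighbors, Subtype.ext_iff]
    · fin_cases i <;> fin_cases j <;> simp [Fin.exists_fin_succ, cornerNeighbors]

open Classical in
/-- The neighbour of an old vertex `x` in the truncated graph that corresponds to `z`. -/
noncomputable def liftNeighbor (v : V) (w : Fin 3 → V) (x z : V) :
    {x // x ≠ v} ⊕ Fin 3 :=
  if hz : z = v then (if w 0 = x then .inr 0 else if w 1 = x then .inr 1 else .inr 2)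
  else .inl ⟨z, hz⟩

theorem truncProj_liftNeighbor (x z : V) :
    truncProj v (liftNeighbor v w x z) = z := by
  unfold liftNeighbor
  split_ifs with h <;> simp [h]

/-- Old vertices keep the numbering of their neighbours, so that demands carry over index by index.
-/
theorem hasNeighbors_inl (hw : HasNeighbors G v w) (x : {x // x ≠ v}) {u : Fin 3 → V}
    (hu : HasNeighbors G x u) :
    HasNeighbors (truncGraph G v w) (.inl x) (fun i => liftNeighbor v w x (u i)) where
  inj := by
    intro a b hab
    apply hu.inj
    simpa [truncProj_liftNeighbor] using congrArg (truncProj v) hab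
  adj_iff := by
    rintro (z | j)
    · rw [truncGraph_inl_inl, hu.adj_iff]
      constructor
      · rintro ⟨i, hi⟩
        refine ⟨i, ?_⟩
        have hz : ¬ u i = v := hi ▸ z.2
        simp only [liftNeighbor, dif_neg hz]
        exact congrArg Sum.inl (Subtype.ext hi)
      · rintro ⟨i, hi⟩
        refine ⟨i, ?_⟩
        simpa [truncProj_liftNeighbor] using congrArg (truncProj v) hi
    · rw [truncGraph_inl_inr]
      constructor
      · intro hj
        obtain ⟨i, hi⟩ := (hu.adj_iff v).1 (hj ▸ (hw.adj j).symm)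
        refine ⟨i, ?_⟩
        have h01 : w 0 ≠ w 1 := fun h => by simpa using hw.inj h
        have h02 : w 0 ≠ w 2 := fun h => by simpa using hw.inj h
        have h12 : w 1 ≠ w 2 := fun h => by simpa using hw.inj h
        simp only [liftNeighbor, hi, dif_pos]
        fin_cases j <;> simp at hj <;> simp [← hj, h01, h02, h12]
      · rintro ⟨i, hi⟩
        have hi' : u i = v := by
          simpa [truncProj_liftNeighbor] using congrArg (truncProj v) hi
        have hxv : G.Adj v x := ((hu.adj_iff v).2 ⟨i, hi'⟩).symm
        obtain ⟨m, hm⟩ := (hw.adj_iff _).1 hxv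
        simp only [liftNeighbor, hi', dif_pos] at hi
        split_ifs at hi with h0 h1
        · cases hi; exact h0
        · cases hi; exact h1
        · cases hi
          fin_cases m
          · exact absurd hm h0
          · exact absurd hm h1
          · exact hm

/-- A set deleted from the truncated graph is pushed down to a set of at most two vertices of `G`,
and walks of `G` avoiding it are lifted. If no corner is deleted, the whole triangle survives and
serves as `v`. If a corner is deleted, `v` is deleted below, and each surviving corner still reaches
an old vertex. -/
theorem isThreeConnected_truncGraph [Fintype V] [Fintype {x // x ≠ v}]
    (hG : IsThreeConnected G) (hw : HasNeighbors G v w) :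
    IsThreeConnected (truncGraph G v w) := by
  classical
  obtain ⟨hcard, hconn⟩ := hG
  refine ⟨?_, ?_⟩
  · have h1 : Fintype.card {x // x ≠ v} = Fintype.card V - 1 := by
      convert Set.card_ne_eq v
    rw [Fintype.card_sum, Fintype.card_fin, h1]
    omega
  intro S hS
  have third : ∀ i j : Fin 3, i ≠ j → ∃ l, l ≠ i ∧ l ≠ j := by decide
  by_cases hT : ∃ i, Sum.inr i ∈ S
  · obtain ⟨i, hi⟩ := hT
    -- The deleted corner is traded for `v`, so the size stays below three.
    set S₁ : Finset V := insert v ((S.erase (.inr i)).image (truncProj v)) with hS₁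
    have hcS : S₁.card < 3 := by
      have h1 : S₁.card ≤ ((S.erase (.inr i)).image (truncProj v)).card + 1 :=
        Finset.card_insert_le _ _
      have h2 : ((S.erase (.inr i)).image (truncProj v)).card ≤ (S.erase (.inr i)).card :=
        Finset.card_image_le
      have h3 := Finset.card_erase_add_one hi
      omega
    have hmem : ∀ x : {x // x ≠ v}, Sum.inl x ∉ S → (x : V) ∉ S₁ := by
      intro x hx
      simp only [hS₁, Finset.mem_insert, Finset.mem_image, Finset.mem_erase, not_or, not_exists]
      refine ⟨x.2, ?_⟩
      rintro (z | j) ⟨⟨_, hz⟩, hzx⟩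
      · rw [truncProj_inl] at hzx
        exact hx (Subtype.ext hzx ▸ hz)
      · exact x.2 hzx.symm
    have hold : ∀ x z : {x // x ≠ v}, Sum.inl x ∉ S → Sum.inl z ∉ S →
        Linked (truncGraph G v w) S (.inl x) (.inl z) := by
      intro x z hx hz
      have key : Linked G S₁ x z := Linked.of_connected (hconn S₁ hcS) (hmem x hx) (hmem z hz)
      have hne : ∀ a, a ∉ S₁ → ∃ ha : a ≠ v, Sum.inl ⟨a, ha⟩ ∉ S := by
        intro a ha
        simp only [hS₁, Finset.mem_insert, Finset.mem_image, Finset.mem_erase, not_or,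
          not_exists] at ha
        exact ⟨ha.1, fun h => ha.2 _ ⟨⟨by simp, h⟩, rfl⟩⟩
      have := key.induction (P := fun a b => ∀ (ha : a ≠ v) (hb : b ≠ v), Sum.inl ⟨a, ha⟩ ∉ S →
        Linked (truncGraph G v w) S (.inl ⟨a, ha⟩) (.inl ⟨b, hb⟩))
        (fun a ha ha' hb h => Linked.refl h)
        (fun a b c ha hb hab ih ha' hc h => by
          obtain ⟨hb', hbS⟩ := hne b hb
          exact (Linked.of_adj (by simpa using hab) h hbS).trans (ih hb' hc hbS))
      exact this x.2 z.2 hx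
    have hnew : ∀ j, Sum.inr j ∉ S → ∃ x, Linked (truncGraph G v w) S (.inr j) (.inl x) := by
      intro j hj
      by_cases hwj : Sum.inl ⟨w j, hw.ne j⟩ ∈ S
      · have hij : i ≠ j := fun h => hj (h ▸ hi)
        obtain ⟨l, hli, hlj⟩ := third i j hij
        -- The two deleted vertices are now both known, so the third corner and its outer neighbour
        -- are free and give a detour.
        have hSeq : S = {.inr i, .inl ⟨w j, hw.ne j⟩} := by
          symm
          apply Finset.eq_of_subset_of_card_le
          · intro x hx
            simp only [Finset.mem_insert, Finset.mem_singleton] at hx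
            rcases hx with rfl | rfl <;> assumption
          · rw [Finset.card_pair (by simp)]
            omega
        have h1 : (Sum.inr l : {x // x ≠ v} ⊕ Fin 3) ∉ S := by simp [hSeq, hli]
        have h2 : Sum.inl ⟨w l, hw.ne l⟩ ∉ S := by
          simp only [hSeq, Finset.mem_insert, reduceCtorEq, Finset.mem_singleton, Sum.inl.injEq,
            Subtype.mk.injEq, false_or]
          exact fun h => hlj (hw.inj h)
        exact ⟨_, (Linked.of_adj (by simpa using hlj.symm) hj h1).trans
          (Linked.of_adj (by simp) h1 h2)⟩
      · exact ⟨_, Linked.of_adj (by simp) hj hwj⟩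
    obtain ⟨⟨b, hb⟩⟩ := (hconn S₁ hcS).nonempty
    have hb' : b ∉ S₁ := by simpa using hb
    simp only [hS₁, Finset.mem_insert, Finset.mem_image, Finset.mem_erase, not_or,
      not_exists] at hb'
    have hbS : Sum.inl ⟨b, hb'.1⟩ ∉ S := fun h => hb'.2 _ ⟨⟨by simp, h⟩, rfl⟩
    refine Linked.connected hbS ?_
    rintro (x | j) hx
    · exact hold _ _ hx hbS
    · obtain ⟨x, hjx⟩ := hnew j hx
      exact hjx.trans (hold _ _ hjx.notMem_right hbS)
  · push Not at hT
    set S₀ : Finset V := S.image (truncProj v) with hS₀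
    have hcS : S₀.card < 3 := lt_of_le_of_lt Finset.card_image_le hS
    have hmem : ∀ x, x ∉ S → truncProj v x ∉ S₀ := by
      intro x hx h
      obtain ⟨z, hz, hzx⟩ := Finset.mem_image.1 h
      rcases z with z | j
      · rcases x with x | i
        · exact hx (Subtype.ext (show (z : V) = x from hzx) ▸ hz)
        · exact z.2 hzx
      · exact hT j hz
    have hmem' : ∀ x, truncProj v x ∉ S₀ → x ∉ S := fun x hx h =>
      hx (Finset.mem_image_of_mem _ h)
    have hfib : ∀ x z, x ∉ S → z ∉ S → truncProj v x = truncProj v z →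
        Linked (truncGraph G v w) S x z := by
      rintro (x | i) (z | j) hx hz h
      · rw [truncProj_inl, truncProj_inl] at h
        rw [Subtype.ext h]
        exact Linked.refl hz
      · exact absurd h x.2
      · exact absurd h.symm z.2
      · by_cases hij : i = j
        · rw [hij]; exact Linked.refl hz
        · exact Linked.of_adj (by simpa using hij) hx hz
    have hedge : ∀ a b, G.Adj a b → ∃ x z, truncProj v x = a ∧ truncProj v z = b ∧
        (truncGraph G v w).Adj x z := by
      intro a b hab
      by_cases ha : a = v
      · subst ha
        obtain ⟨i, rfl⟩ := (hw.adj_iff b).1 hab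
        exact ⟨.inr i, .inl ⟨w i, hw.ne i⟩, rfl, rfl, by simp⟩
      · by_cases hb : b = v
        · subst hb
          obtain ⟨i, rfl⟩ := (hw.adj_iff a).1 hab.symm
          exact ⟨.inl ⟨w i, hw.ne i⟩, .inr i, rfl, rfl, by simp⟩
        · exact ⟨.inl ⟨a, ha⟩, .inl ⟨b, hb⟩, rfl, rfl, by simpa using hab⟩
    have hall : ∀ x z, x ∉ S → z ∉ S → Linked (truncGraph G v w) S x z := by
      intro x z hx hz
      have key := Linked.of_connected (hconn S₀ hcS) (hmem x hx) (hmem z hz)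
      have := key.induction (P := fun a b => ∀ x z, x ∉ S → z ∉ S → truncProj v x = a →
        truncProj v z = b → Linked (truncGraph G v w) S x z)
        (fun a _ x z hx hz hxa hza => hfib x z hx hz (hxa.trans hza.symm))
        (fun a b c ha hb hab ih x z hx hz hxa hzc => by
          obtain ⟨x', y', rfl, rfl, hxy⟩ := hedge a b hab
          exact ((hfib x x' hx (hmem' _ ha) hxa).trans
            (Linked.of_adj hxy (hmem' _ ha) (hmem' _ hb))).trans
              (ih y' z (hmem' _ hb) hz rfl hzc))
      exact this x z hx hz rfl rfl
    exact Linked.connected (hT 0) fun x hx => hall x _ hx (hT 0)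

end Trunc

/-! ### Straight-line drawings and their truncation. -/

/-- The straight segment representing a pair of vertices. -/
noncomputable def edgeSegment {V : Type*} (pt : V → ℂ) : Sym2 V → Set ℂ :=
  Sym2.lift ⟨fun u v => segment ℝ (pt u) (pt v), fun _ _ => segment_symm ℝ _ _⟩

@[simp] theorem edgeSegment_mk {V : Type*} (pt : V → ℂ) (u v : V) :
    edgeSegment pt s(u, v) = segment ℝ (pt u) (pt v) := rfl

/-- A drawing of `G` by straight segments in which distinct edges meet only in common ends. -/
structure IsStraightDrawing {V : Type*} (G : SimpleGraph V) (pt : V → ℂ) : Prop where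
  inj : Function.Injective pt
  inter : ∀ e ∈ G.edgeSet, ∀ f ∈ G.edgeSet, e ≠ f → ∀ q ∈ edgeSegment pt e,
    q ∈ edgeSegment pt f → ∃ t, t ∈ e ∧ t ∈ f ∧ pt t = q

theorem isPlanar_of_isStraightDrawing {V : Type*} {G : SimpleGraph V} {pt : V → ℂ}
    (hpt : IsStraightDrawing G pt) (hG : ∀ v, ∃ w, HasNeighbors G v w) : IsPlanar G := by
  let φ : ℂ ≃L[ℝ] ℝ × ℝ := Complex.equivRealProdCLM
  refine ⟨⟨φ ∘ pt, fun e => φ '' edgeSegment pt e, φ.injective.comp hpt.inj, ?_, ?_, ?_⟩⟩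
  · intro u v huv
    have hne : pt u ≠ pt v := fun h => huv.ne (hpt.inj h)
    refine ⟨⟨⟨fun t => φ (AffineMap.lineMap (pt u) (pt v) (t : ℝ)), ?_⟩, ?_, ?_⟩, ?_, ?_⟩
    · exact φ.continuous.comp ((AffineMap.lineMap_continuous).comp continuous_subtype_val)
    · simp
    · simp
    · intro s t hst
      exact Subtype.ext (AffineMap.lineMap_injective ℝ hne (φ.injective hst))
    · rw [edgeSegment_mk, segment_eq_image_lineMap, ← Set.image_comp]
      ext q
      constructor
      · rintro ⟨t, rfl⟩
        exact ⟨t, t.2, rfl⟩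
      · rintro ⟨t, ht, rfl⟩
        exact ⟨⟨t, ht⟩, rfl⟩
  · rintro e he w ⟨q, hq, hqw⟩
    have hqw : q = pt w := φ.injective hqw
    subst hqw
    by_contra hw
    -- A vertex on a foreign edge is excluded by comparing that edge with one that starts at the
    -- vertex; this is where isolated vertices would do harm.
    obtain ⟨u, hu⟩ := hG w
    obtain ⟨t, hte, htf, ht⟩ := hpt.inter e he s(w, u 0) (hu.adj 0)
      (fun h => hw (h ▸ Sym2.mem_mk_left _ _)) _ hq (left_mem_segment ℝ _ _)
    exact hw (hpt.inj ht ▸ hte)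
  · rintro e he f hf hef q ⟨⟨q₁, h₁, rfl⟩, ⟨q₂, h₂, h⟩⟩
    have h : q₂ = q₁ := φ.injective h
    subst h
    obtain ⟨t, hte, htf, ht⟩ := hpt.inter e he f hf hef _ h₁ h₂
    exact ⟨t, ⟨hte, htf⟩, congrArg φ ht⟩

/-- Two chords of a circle with a common end and distinct other ends meet only in that end. -/
theorem eq_of_mem_chords {P a b c q : ℂ} {δ : ℝ} (ha : ‖a - P‖ = δ) (hb : ‖b - P‖ = δ)
    (hc : ‖c - P‖ = δ) (hbc : b ≠ c) (hab : a ≠ b) (hac : a ≠ c) (h1 : q ∈ segment ℝ a b)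
    (h2 : q ∈ segment ℝ a c) : q = a := by
  by_contra hqa
  have hcos : EuclideanGeometry.Cospherical (Set.range ![a, b, c]) := by
    refine ⟨P, δ, ?_⟩
    rintro _ ⟨i, rfl⟩
    fin_cases i <;> simp [dist_eq_norm, ha, hb, hc]
  have hinj : Function.Injective ![a, b, c] := by
    intro i j
    fin_cases i <;> fin_cases j <;> simp [hab, hac, hbc, hab.symm, hac.symm, hbc.symm]
  have haff := hcos.affineIndependent le_rfl hinj
  rw [affineIndependent_iff_not_collinear_set] at haff
  apply haff
  rw [segment_eq_image_lineMap] at h1 h2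
  obtain ⟨s, _, rfl⟩ := h1
  obtain ⟨t, _, ht⟩ := h2
  rw [AffineMap.lineMap_apply, AffineMap.lineMap_apply] at ht
  simp only [vsub_eq_sub, vadd_eq_add, add_left_inj] at ht
  have ht0 : t ≠ 0 := by
    rintro rfl
    apply hqa
    rw [AffineMap.lineMap_apply]
    simp [← ht]
  rw [collinear_iff_of_mem (p₀ := a) (by simp)]
  refine ⟨b - a, ?_⟩
  intro p hp
  simp only [Set.mem_insert_iff, Set.mem_singleton_iff] at hp
  rcases hp with rfl | rfl | rfl
  · exact ⟨0, by simp⟩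
  · exact ⟨1, by simp⟩
  · refine ⟨t⁻¹ * s, ?_⟩
    rw [mul_smul, ← ht, smul_smul, inv_mul_cancel₀ ht0]
    simp

section Trunc

variable {V : Type*} {G : SimpleGraph V} {v : V} {w : Fin 3 → V}

/-- The point at distance `δ` from `P` in the direction of `Q`. -/
noncomputable def pointToward (P Q : ℂ) (δ : ℝ) : ℂ := P + (δ / ‖Q - P‖) • (Q - P)

theorem norm_pointToward_sub {P Q : ℂ} {δ : ℝ} (hδ : 0 < δ) (hQ : δ < ‖Q - P‖) :
    ‖pointToward P Q δ - P‖ = δ := by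
  have : 0 < ‖Q - P‖ := hδ.trans hQ
  rw [pointToward, add_sub_cancel_left, norm_smul, Real.norm_of_nonneg (by positivity)]
  field_simp

theorem pointToward_mem_segment {P Q : ℂ} {δ : ℝ} (hδ : 0 < δ) (hQ : δ < ‖Q - P‖) :
    pointToward P Q δ ∈ segment ℝ P Q := by
  have : 0 < ‖Q - P‖ := hδ.trans hQ
  rw [segment_eq_image']
  exact ⟨δ / ‖Q - P‖, ⟨by positivity, by rw [div_le_one this]; exact hQ.le⟩, rfl⟩

theorem segment_pointToward_subset {P Q : ℂ} {δ : ℝ} (hδ : 0 < δ) (hQ : δ < ‖Q - P‖) :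
    segment ℝ Q (pointToward P Q δ) ⊆ segment ℝ Q P :=
  (convex_segment Q P).segment_subset (left_mem_segment ℝ _ _)
    (segment_symm ℝ P Q ▸ pointToward_mem_segment hδ hQ)

theorem norm_sub_of_mem_segment_pointToward {P Q q : ℂ} {δ : ℝ} (hδ : 0 < δ) (hQ : δ < ‖Q - P‖)
    (hq : q ∈ segment ℝ Q (pointToward P Q δ)) :
    δ ≤ ‖q - P‖ ∧ (‖q - P‖ = δ → q = pointToward P Q δ) := by
  have hL : 0 < ‖Q - P‖ := hδ.trans hQ
  rw [segment_symm, segment_eq_image'] at hq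
  obtain ⟨t, ⟨ht0, ht1⟩, rfl⟩ := hq
  have h1 : δ / ‖Q - P‖ < 1 := by rwa [div_lt_one hL]
  have key : pointToward P Q δ + t • (Q - pointToward P Q δ) - P
      = (δ / ‖Q - P‖ + t * (1 - δ / ‖Q - P‖)) • (Q - P) := by
    simp only [pointToward, Complex.real_smul]
    push_cast
    ring
  have hnn : 0 ≤ δ / ‖Q - P‖ + t * (1 - δ / ‖Q - P‖) := by
    have : 0 ≤ t * (1 - δ / ‖Q - P‖) := mul_nonneg ht0 (by linarith)
    positivity
  have hnorm : ‖pointToward P Q δ + t • (Q - pointToward P Q δ) - P‖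
      = δ + t * (‖Q - P‖ - δ) := by
    rw [key, norm_smul, Real.norm_of_nonneg hnn]
    field_simp
  have hpos : 0 < ‖Q - P‖ - δ := by linarith
  rw [hnorm]
  refine ⟨by nlinarith, fun h => ?_⟩
  have : t = 0 := by
    have : t * (‖Q - P‖ - δ) = 0 := by linarith
    rcases mul_eq_zero.1 this with h | h
    · exact h
    · exact absurd h hpos.ne'
  simp [this]

theorem norm_sub_of_mem_chord {P a b q : ℂ} {δ : ℝ} (ha : ‖a - P‖ = δ) (hb : ‖b - P‖ = δ)
    (hab : a ≠ b) (hq : q ∈ segment ℝ a b) :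
    ‖q - P‖ ≤ δ ∧ (‖q - P‖ = δ → q = a ∨ q = b) := by
  have ha' : a ∈ Metric.closedBall P δ := by simp [dist_eq_norm, ha]
  have hb' : b ∈ Metric.closedBall P δ := by simp [dist_eq_norm, hb]
  rw [← insert_endpoints_openSegment] at hq
  rcases hq with rfl | rfl | hq
  · exact ⟨ha.le, fun _ => Or.inl rfl⟩
  · exact ⟨hb.le, fun _ => Or.inr rfl⟩
  · have h := openSegment_subset_ball_of_ne ha' hb' hab hq
    rw [Metric.mem_ball, dist_eq_norm] at h
    exact ⟨h.le, fun h' => absurd h' h.ne⟩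

/-- The positions of the vertices after truncation at `v`. -/
noncomputable def truncPoint (pt : V → ℂ) (v : V) (w : Fin 3 → V) (δ : ℝ) :
    {x // x ≠ v} ⊕ Fin 3 → ℂ :=
  Sum.elim (fun x => pt x) fun i => pointToward (pt v) (pt (w i)) δ

theorem truncGraph_edge_cases (hw : HasNeighbors G v w) {e : Sym2 ({x // x ≠ v} ⊕ Fin 3)}
    (he : e ∈ (truncGraph G v w).edgeSet) :
    (∃ x z : {x // x ≠ v}, G.Adj x z ∧ e = s(.inl x, .inl z)) ∨
      (∃ i, e = s(.inl ⟨w i, hw.ne i⟩, .inr i)) ∨ ∃ i j, i ≠ j ∧ e = s(.inr i, .inr j) := by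
  induction e using Sym2.ind with
  | _ a b =>
    rw [SimpleGraph.mem_edgeSet] at he
    rcases a with x | i <;> rcases b with z | j
    · exact Or.inl ⟨x, z, he, rfl⟩
    · rw [truncGraph_inl_inr] at he
      refine Or.inr (Or.inl ⟨j, ?_⟩)
      rw [show x = ⟨w j, hw.ne j⟩ from Subtype.ext he.symm]
    · rw [truncGraph_inr_inl] at he
      refine Or.inr (Or.inl ⟨i, ?_⟩)
      rw [show z = ⟨w i, hw.ne i⟩ from Subtype.ext he.symm, Sym2.eq_swap]
    · exact Or.inr (Or.inr ⟨i, j, he, rfl⟩)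

theorem IsStraightDrawing.notMem_segment {pt : V → ℂ} (hpt : IsStraightDrawing G pt)
    (hw : HasNeighbors G v w) {x z : V} (hxz : G.Adj x z) (hx : x ≠ v) (hz : z ≠ v) :
    pt v ∉ segment ℝ (pt x) (pt z) := by
  intro h
  have hv : v ∉ s(x, z) := by simp [hx.symm, hz.symm]
  obtain ⟨t, ht, _, htv⟩ := hpt.inter s(x, z) hxz s(v, w 0) (hw.adj 0)
    (fun h => hv (h ▸ Sym2.mem_mk_left _ _)) _ h (left_mem_segment ℝ _ _)
  exact hv (hpt.inj htv ▸ ht)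

theorem IsStraightDrawing.exists_radius [Finite V] {pt : V → ℂ} (hpt : IsStraightDrawing G pt)
    (hw : HasNeighbors G v w) : ∃ δ : ℝ, 0 < δ ∧ (∀ x, x ≠ v → δ < ‖pt x - pt v‖) ∧
      ∀ x z, G.Adj x z → x ≠ v → z ≠ v → ∀ q ∈ segment ℝ (pt x) (pt z), δ < ‖q - pt v‖ := by
  have small : ∀ r : ℝ, 0 < r → ∀ᶠ δ in nhdsWithin (0 : ℝ) (Set.Ioi 0), δ < r := fun r hr =>
    nhdsWithin_le_nhds (Iio_mem_nhds hr)
  have h1 : ∀ᶠ δ in nhdsWithin (0 : ℝ) (Set.Ioi 0), ∀ x, x ≠ v → δ < ‖pt x - pt v‖ := by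
    rw [Filter.eventually_all]
    intro x
    by_cases hx : x = v
    · simp [hx]
    · filter_upwards [small ‖pt x - pt v‖ (norm_pos_iff.2 (sub_ne_zero.2 (hpt.inj.ne hx)))]
        with δ hδ _ using hδ
  have h2 : ∀ᶠ δ in nhdsWithin (0 : ℝ) (Set.Ioi 0), ∀ x z, G.Adj x z → x ≠ v → z ≠ v →
      ∀ q ∈ segment ℝ (pt x) (pt z), δ < ‖q - pt v‖ := by
    rw [Filter.eventually_all]
    intro x
    rw [Filter.eventually_all]
    intro z
    by_cases h : G.Adj x z ∧ x ≠ v ∧ z ≠ v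
    · have hcl : IsCompact (segment ℝ (pt x) (pt z)) := by
        rw [segment_eq_image_lineMap]
        exact isCompact_Icc.image AffineMap.lineMap_continuous
      have hpos : 0 < Metric.infDist (pt v) (segment ℝ (pt x) (pt z)) :=
        (hcl.isClosed.notMem_iff_infDist_pos ⟨_, left_mem_segment ℝ _ _⟩).1
          (hpt.notMem_segment hw h.1 h.2.1 h.2.2)
      filter_upwards [small _ hpos] with δ hδ _ _ _ q hq
      refine hδ.trans_le ((Metric.infDist_le_dist_of_mem hq).trans_eq ?_)
      rw [dist_comm, dist_eq_norm]
    · exact Filter.Eventually.of_forall fun δ a b c => absurd ⟨a, b, c⟩ h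
  obtain ⟨δ, hδ1, hδ2, hδ⟩ := (h1.and (h2.and self_mem_nhdsWithin)).exists
  exact ⟨δ, hδ, hδ1, hδ2⟩

/-- The corners are put where the three edges at `v` meet a circle around `pt v` so small that no
other edge or vertex reaches its disc. Shortened edges stay outside the open disc and chords stay
inside the closed one, so they meet only on the circle, at corners. -/
theorem IsStraightDrawing.exists_truncGraph [Finite V] {pt : V → ℂ}
    (hpt : IsStraightDrawing G pt) (hw : HasNeighbors G v w) :
    ∃ pt', IsStraightDrawing (truncGraph G v w) pt' := by
  obtain ⟨δ, hδ, hfar, hedge⟩ := hpt.exists_radius hw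
  have hfw : ∀ i, δ < ‖pt (w i) - pt v‖ := fun i => hfar _ (hw.ne i)
  set q : Fin 3 → ℂ := fun i => pointToward (pt v) (pt (w i)) δ with hq
  have hqn : ∀ i, ‖q i - pt v‖ = δ := fun i => norm_pointToward_sub hδ (hfw i)
  have common : ∀ i j, i ≠ j → ∀ r, r ∈ segment ℝ (pt (w i)) (pt v) →
      r ∈ segment ℝ (pt (w j)) (pt v) → r = pt v := by
    intro i j hij r h1 h2
    have hne : s(w i, v) ≠ s(w j, v) := by
      intro h
      rcases Sym2.eq_iff.1 h with ⟨h, _⟩ | ⟨h, _⟩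
      · exact hij (hw.inj h)
      · exact hw.ne i h
    obtain ⟨t, ht1, ht2, rfl⟩ := hpt.inter s(w i, v) (hw.adj i).symm s(w j, v) (hw.adj j).symm
      hne r h1 h2
    rw [Sym2.mem_iff] at ht1 ht2
    rcases ht1 with rfl | rfl
    · rcases ht2 with h | h
      · exact absurd (hw.inj h) hij
      · rw [h]
    · rfl
  have sub : ∀ i, segment ℝ (pt (w i)) (q i) ⊆ segment ℝ (pt (w i)) (pt v) := fun i =>
    segment_pointToward_subset hδ (hfw i)
  have hqinj : Function.Injective q := by
    intro i j hij
    by_contra hne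
    have := common i j hne (q i) (sub i (right_mem_segment ℝ _ _))
      (hij ▸ sub j (right_mem_segment ℝ _ _))
    have h := hqn i
    rw [this, sub_self, norm_zero] at h
    exact hδ.ne h
  have spoke : ∀ i r, r ∈ segment ℝ (pt (w i)) (q i) →
      δ ≤ ‖r - pt v‖ ∧ (‖r - pt v‖ = δ → r = q i) := fun i r hr =>
    norm_sub_of_mem_segment_pointToward hδ (hfw i) hr
  have chord : ∀ i j, i ≠ j → ∀ r, r ∈ segment ℝ (q i) (q j) →
      ‖r - pt v‖ ≤ δ ∧ (‖r - pt v‖ = δ → r = q i ∨ r = q j) := fun i j hij r hr =>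
    norm_sub_of_mem_chord (hqn i) (hqn j) (hqinj.ne hij) hr
  refine ⟨truncPoint pt v w δ, ?_, ?_⟩
  · rintro (x | i) (z | j) h
    · exact congrArg Sum.inl (Subtype.ext (hpt.inj h))
    · have h : pt x = q j := h
      have h' := hfar x x.2
      rw [h, hqn] at h'
      exact absurd h' (lt_irrefl _)
    · have h : q i = pt z := h
      have h' := hfar z z.2
      rw [← h, hqn] at h'
      exact absurd h' (lt_irrefl _)
    · exact congrArg Sum.inr (hqinj h)
  set pt' := truncPoint pt v w δ with hpt'
  have AB : ∀ (x z : {x // x ≠ v}) (i : Fin 3), G.Adj x z → ∀ r,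
      r ∈ segment ℝ (pt x) (pt z) → r ∈ segment ℝ (pt (w i)) (q i) →
      ∃ t, t ∈ s(Sum.inl x, Sum.inl z) ∧ t ∈ s(Sum.inl ⟨w i, hw.ne i⟩, Sum.inr i) ∧
        pt' t = r := by
    intro x z i hxz r h1 h2
    have hv : v ∉ s((x : V), (z : V)) := by simp [x.2.symm, z.2.symm]
    obtain ⟨t, ht1, ht2, rfl⟩ := hpt.inter s((x : V), (z : V)) hxz s(w i, v) (hw.adj i).symm
      (fun h => hv (h ▸ Sym2.mem_mk_right _ _)) r h1 (sub i h2)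
    have htv : t ≠ v := fun h => hv (h ▸ ht1)
    rw [Sym2.mem_iff] at ht1 ht2
    refine ⟨.inl ⟨t, htv⟩, ?_, ?_, rfl⟩
    · rcases ht1 with h | h <;> simp [h]
    · rcases ht2 with h | h
      · simp [h]
      · exact absurd h htv
  have AT : ∀ (x z : {x // x ≠ v}) (i j : Fin 3), G.Adj x z → i ≠ j → ∀ r,
      r ∈ segment ℝ (pt x) (pt z) → r ∈ segment ℝ (q i) (q j) → False := by
    intro x z i j hxz hij r h1 h2
    exact absurd (hedge x z hxz x.2 z.2 r h1) (not_lt.2 (chord i j hij r h2).1)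
  have BB : ∀ i j, i ≠ j → ∀ r, r ∈ segment ℝ (pt (w i)) (q i) →
      r ∈ segment ℝ (pt (w j)) (q j) → False := by
    intro i j hij r h1 h2
    have h := (spoke i r h1).1
    rw [common i j hij r (sub i h1) (sub j h2), sub_self, norm_zero] at h
    exact absurd hδ (not_lt.2 h)
  have BT : ∀ i j l, j ≠ l → ∀ r, r ∈ segment ℝ (pt (w i)) (q i) →
      r ∈ segment ℝ (q j) (q l) →
      ∃ t, t ∈ s(Sum.inl ⟨w i, hw.ne i⟩, Sum.inr i) ∧ t ∈ s(Sum.inr j, Sum.inr l) ∧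
        pt' t = r := by
    intro i j l hjl r h1 h2
    have hr : ‖r - pt v‖ = δ := le_antisymm (chord j l hjl r h2).1 (spoke i r h1).1
    have hri := (spoke i r h1).2 hr
    refine ⟨.inr i, by simp, ?_, hri.symm⟩
    rcases (chord j l hjl r h2).2 hr with h | h
    · rw [hqinj (hri.symm.trans h)]; simp
    · rw [hqinj (hri.symm.trans h)]; simp
  have TT : ∀ i j l : Fin 3, i ≠ j → i ≠ l → j ≠ l → ∀ r, r ∈ segment ℝ (q i) (q j) →
      r ∈ segment ℝ (q i) (q l) → q i = r := by
    intro i j l hij hil hjl r h1 h2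
    exact (eq_of_mem_chords (hqn i) (hqn j) (hqn l) (hqinj.ne hjl) (hqinj.ne hij)
      (hqinj.ne hil) h1 h2).symm
  intro e he f hf hef r hre hrf
  rcases truncGraph_edge_cases hw he with ⟨x, z, hxz, rfl⟩ | ⟨i, rfl⟩ | ⟨i, j, hij, rfl⟩ <;>
  rcases truncGraph_edge_cases hw hf with ⟨x', z', hxz', rfl⟩ | ⟨i', rfl⟩ | ⟨i', j', hij', rfl⟩
  · have hne : s((x : V), (z : V)) ≠ s((x' : V), (z' : V)) := by
      intro h
      apply hef
      rcases Sym2.eq_iff.1 h with ⟨h1, h2⟩ | ⟨h1, h2⟩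
      · rw [Subtype.ext h1, Subtype.ext h2]
      · rw [Subtype.ext h1, Subtype.ext h2, Sym2.eq_swap]
    obtain ⟨t, ht1, ht2, rfl⟩ := hpt.inter _ hxz _ hxz' hne r hre hrf
    have htv : t ≠ v := by
      rintro rfl
      rcases Sym2.mem_iff.1 ht1 with h | h
      · exact x.2 h.symm
      · exact z.2 h.symm
    refine ⟨.inl ⟨t, htv⟩, ?_, ?_, rfl⟩
    · rcases Sym2.mem_iff.1 ht1 with h | h <;> simp [h]
    · rcases Sym2.mem_iff.1 ht2 with h | h <;> simp [h]
  · exact AB x z i' hxz r hre hrf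
  · exact (AT x z i' j' hxz hij' r hre hrf).elim
  · obtain ⟨t, h1, h2, h3⟩ := AB x' z' i hxz' r hrf hre
    exact ⟨t, h2, h1, h3⟩
  · exact (BB i i' (fun h => hef (by subst h; rfl)) r hre hrf).elim
  · exact BT i i' j' hij' r hre hrf
  · exact (AT x' z' i j hxz' hij r hrf hre).elim
  · obtain ⟨t, h1, h2, h3⟩ := BT i' i j hij r hrf hre
    exact ⟨t, h2, h1, h3⟩
  -- Two different sides of a triangle share exactly one corner; the cases say which.
  · have hcase : ∀ i j i' j' : Fin 3, i ≠ j → i' ≠ j' → ¬(i = i' ∧ j = j') →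
        ¬(i = j' ∧ j = i') → (i = i' ∧ j ≠ j') ∨ (i = j' ∧ j ≠ i') ∨ (j = i' ∧ i ≠ j') ∨
        (j = j' ∧ i ≠ i') := by decide
    have hre : r ∈ segment ℝ (q i) (q j) := hre
    have hrf : r ∈ segment ℝ (q i') (q j') := hrf
    rcases hcase i j i' j' hij hij' (by rintro ⟨rfl, rfl⟩; exact hef rfl)
      (by rintro ⟨rfl, rfl⟩; exact hef Sym2.eq_swap) with ⟨rfl, h⟩ | ⟨rfl, h⟩ | ⟨rfl, h⟩ | ⟨rfl, h⟩
    · exact ⟨.inr i, by simp, by simp, TT i j j' hij hij' h r hre hrf⟩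
    · rw [segment_symm] at hrf
      exact ⟨.inr i, by simp, by simp, TT i j i' hij hij'.symm h r hre hrf⟩
    · rw [segment_symm] at hre
      exact ⟨.inr j, by simp, by simp, TT j i j' hij.symm hij' h r hre hrf⟩
    · rw [segment_symm] at hre hrf
      exact ⟨.inr j, by simp, by simp, TT j i i' hij.symm hij'.symm h r hre hrf⟩

end Trunc

/-! ### Truncation plans and the weight of even subgraphs. -/

section Stage

variable {B V : Type}

open Classical in
/-- Twice the total length of the edges of `C`, where the edge `vx` has length
`1 + (y v x + y x v) / 2`. -/
noncomputable def dartWeight [Fintype V] (C : SimpleGraph V) (y : V → V → ℕ) : ℕ :=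
  ∑ v, ∑ x, if C.Adj v x then 1 + y v x else 0

open Classical in
/-- All degrees of `C` are even. -/
def HasEvenDegrees [Fintype V] (C : SimpleGraph V) : Prop :=
  ∀ v, Even (∑ x, if C.Adj v x then 1 else 0)

/-- The truncations that remain to be done at `v` all take place at the corner pointing to one
neighbour. -/
def IsLadderDemand (G : SimpleGraph V) (y : V → V → ℕ) (ρ : V → ℕ) (v : V) : Prop :=
  ∃ w m, HasNeighbors G v w ∧ ∀ i, y v (w i) = if i = m then 2 * ρ v else 0

/-- After one truncation at `v`, the remaining ones can be distributed over the three corners so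
that the demand `y` is met. -/
def IsSplitDemand (G : SimpleGraph V) (y : V → V → ℕ) (ρ : V → ℕ) (v : V) (w : Fin 3 → V)
    (r : Fin 3 → ℕ) : Prop :=
  HasNeighbors G v w ∧ ∑ i, r i + 1 = ρ v ∧
    ∀ i j, i ≠ j → y v (w i) + y v (w j) ≤ 2 * r i + 2 * r j + 2

/-- All remaining truncations go to corner `m`. The triangle itself contributes one extra vertex to
a passage, which accounts for the 2 by which the demand at `m` drops. -/
theorem IsLadderDemand.exists_isSplitDemand {G : SimpleGraph V} {y : V → V → ℕ} {ρ : V → ℕ}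
    {v : V} (h : IsLadderDemand G y ρ v) (hρ : ρ v ≠ 0) : ∃ w r, IsSplitDemand G y ρ v w r := by
  obtain ⟨w, m, hw, hy⟩ := h
  refine ⟨w, fun i => if i = m then ρ v - 1 else 0, hw, ?_, ?_⟩
  · rw [Finset.sum_ite_eq' Finset.univ m]
    simp only [Finset.mem_univ, if_true]
    omega
  · intro i j hij
    simp only [hy]
    split_ifs <;> omega

open Classical in
/-- A graph `G` together with a map `π` to `B` and a plan of further truncations: `ρ v`
truncations remain to be done inside `v`, and they lengthen the edges as prescribed by `y`. -/
structure TruncationPlan [Fintype V] (K L : ℕ) (G : SimpleGraph V) (π : V → B)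
    (y : V → V → ℕ) (ρ : V → ℕ) : Prop where
  threeConnected : IsThreeConnected G
  drawing : ∃ pt, IsStraightDrawing G pt
  surjective : Function.Surjective π
  fibre_le : ∀ b, (∑ x, if π x = b then 1 + 2 * ρ x else 0) ≤ K
  heavy : ∀ C ≤ G, HasEvenDegrees C → L ≤ dartWeight C y ∨ ∀ u v, C.Adj u v → π u = π v
  demand : ∀ v, IsLadderDemand G y ρ v ∨ ∃ w r, IsSplitDemand G y ρ v w r

theorem TruncationPlan.exists_hasNeighbors [Fintype V] {K L : ℕ} {G : SimpleGraph V} {π : V → B}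
    {y : V → V → ℕ} {ρ : V → ℕ} (h : TruncationPlan K L G π y ρ) (v : V) :
    ∃ w, HasNeighbors G v w := by
  rcases h.demand v with ⟨w, _, hw, _⟩ | ⟨w, _, hw, _⟩ <;> exact ⟨w, hw⟩

/-- The demand after truncation at `v`. -/
def truncDemand (y : V → V → ℕ) (v : V) (r : Fin 3 → ℕ) :
    {x // x ≠ v} ⊕ Fin 3 → {x // x ≠ v} ⊕ Fin 3 → ℕ
  | .inl x, t => y x (truncProj v t)
  | .inr i, .inl _ => 2 * r i
  | .inr _, .inr _ => 0

/-- The subgraph of `G` obtained by contracting the new triangle in a subgraph of the truncated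
graph. -/
def contract (v : V) (C : SimpleGraph ({x // x ≠ v} ⊕ Fin 3)) : SimpleGraph V where
  Adj a b := a ≠ b ∧ ∃ s t, truncProj v s = a ∧ truncProj v t = b ∧ C.Adj s t
  symm := ⟨fun _ _ ⟨h, s, t, hs, ht, hst⟩ => ⟨h.symm, t, s, ht, hs, hst.symm⟩⟩
  loopless := ⟨fun _ h => h.1 rfl⟩

variable {G : SimpleGraph V} {v : V} {w : Fin 3 → V} {C : SimpleGraph ({x // x ≠ v} ⊕ Fin 3)}

theorem contract_le (hw : HasNeighbors G v w) (hC : C ≤ truncGraph G v w) : contract v C ≤ G := by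
  rintro a b ⟨hab, s, t, rfl, rfl, hst⟩
  have h := hC hst
  rcases s with x | i <;> rcases t with z | j
  · exact h
  · rw [truncGraph_inl_inr] at h
    simpa [← h] using (hw.adj j).symm
  · rw [truncGraph_inr_inl] at h
    simpa [← h] using hw.adj i
  · exact absurd rfl hab

theorem contract_adj_corner (hw : HasNeighbors G v w) (hC : C ≤ truncGraph G v w) (i : Fin 3) :
    (contract v C).Adj v (w i) ↔ C.Adj (.inr i) (.inl ⟨w i, hw.ne i⟩) := by
  constructor
  · rintro ⟨_, s, t, hs, ht, hst⟩
    rcases s with x | j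
    · exact absurd hs x.2
    rcases t with z | l
    · have h := hC hst
      rw [truncGraph_inr_inl] at h
      have ht : (z : V) = w i := ht
      rw [show z = ⟨w i, hw.ne i⟩ from Subtype.ext ht] at hst
      rwa [hw.inj (h.trans ht)] at hst
    · exact absurd ht.symm (hw.ne i)
  · intro h
    exact ⟨(hw.ne i).symm, _, _, rfl, rfl, h⟩

theorem contract_adj_old (hw : HasNeighbors G v w) (hC : C ≤ truncGraph G v w)
    (x : {x // x ≠ v}) {u : Fin 3 → V} (hu : HasNeighbors G x u) (i : Fin 3) :
    (contract v C).Adj x (u i) ↔ C.Adj (.inl x) (liftNeighbor v w x (u i)) := by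
  constructor
  · rintro ⟨_, s, t, hs, ht, hst⟩
    rcases s with x' | j
    · have hx : x' = x := Subtype.ext hs
      subst hx
      obtain ⟨m, rfl⟩ := ((hasNeighbors_inl hw x' hu).adj_iff t).1 (hC hst)
      rw [truncProj_liftNeighbor] at ht
      rwa [ht] at hst
    · exact absurd hs.symm x.2
  · intro h
    exact ⟨(hu.adj i).ne, _, _, rfl, truncProj_liftNeighbor _ _, h⟩

open Classical in
-- Away from the triangle, contraction changes neither degrees nor weights.
theorem sum_old [Fintype V] (hw : HasNeighbors G v w) (hC : C ≤ truncGraph G v w)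
    (x : {x // x ≠ v}) (hx : ∃ u, HasNeighbors G x u) (g : V → ℕ) :
    (∑ z, if (contract v C).Adj x z then g z else 0)
      = ∑ t, if C.Adj (.inl x) t then g (truncProj v t) else 0 := by
  obtain ⟨u, hu⟩ := hx
  rw [hu.sum_ite (contract_le hw hC), (hasNeighbors_inl hw x hu).sum_ite hC]
  refine Finset.sum_congr rfl fun i _ => ?_
  rw [truncProj_liftNeighbor]
  simp only [contract_adj_old hw hC x hu]

open Classical in
-- By parity an even subgraph uses none or two of the three edges leaving the triangle. If it leaves
-- at corners `i` and `j`, each of these contributes at least (1 + 2rᵢ) + 1 or (1 + 2rⱼ) + 1,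
-- altogether 2rᵢ + 2rⱼ + 4, while the contracted vertex contributes 2 plus the two demands. This is
-- why `hr` has its form.
theorem contract_corner_aux [Fintype V] {y : V → V → ℕ} {r : Fin 3 → ℕ}
    (hw : HasNeighbors G v w) (hC : C ≤ truncGraph G v w) (hev : HasEvenDegrees C)
    (hr : ∀ i j, i ≠ j → y v (w i) + y v (w j) ≤ 2 * r i + 2 * r j + 2) :
    Even (∑ x, if (contract v C).Adj v x then 1 else 0) ∧
    (∑ x, if (contract v C).Adj v x then 1 + y v x else 0)
      ≤ ∑ i : Fin 3, ∑ t, if C.Adj (.inr i) t then 1 + truncDemand y v r (.inr i) t else 0 := by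
  have hs : ∀ (i : Fin 3) (g : {x // x ≠ v} ⊕ Fin 3 → ℕ),
      (∑ t, if C.Adj (.inr i) t then g t else 0) = ∑ j, if C.Adj (.inr i) (cornerNeighbors hw i j)
        then g (cornerNeighbors hw i j) else 0 := fun i g =>
    (hasNeighbors_corner hw i).sum_ite hC g
  have hev' : ∀ i : Fin 3, Even (∑ j, if C.Adj (.inr i) (cornerNeighbors hw i j) then 1 else 0) :=
    fun i => by
      rw [← hs i fun _ => 1]
      exact hev (.inr i)
  simp only [hs]
  rw [hw.sum_ite (contract_le hw hC), hw.sum_ite (contract_le hw hC)]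
  simp only [contract_adj_corner hw hC]
  have e0 := hev' 0
  have e1 := hev' 1
  have e2 := hev' 2
  have r01 := hr 0 1 (by decide)
  have r02 := hr 0 2 (by decide)
  have r12 := hr 1 2 (by decide)
  have a1 : (1 : Fin 3) + 1 = 2 := rfl
  have a2 : (1 : Fin 3) + 2 = 0 := rfl
  have a3 : (2 : Fin 3) + 1 = 0 := rfl
  have a4 : (2 : Fin 3) + 2 = 1 := rfl
  simp only [Fin.sum_univ_three, cornerNeighbors, Matrix.cons_val_zero, Matrix.cons_val_one,
    Matrix.cons_val, zero_add, a1, a2, a3, a4, truncDemand, C.adj_comm (.inr 1) (.inr 0),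
    C.adj_comm (.inr 2) (.inr 0), C.adj_comm (.inr 2) (.inr 1)] at e0 e1 e2 ⊢
  simp only [Nat.even_iff] at e0 e1 e2 ⊢
  -- All 64 choices of edges at the triangle; those of odd degree somewhere contradict `e0`, `e1`,
  -- `e2`.
  by_cases o0 : C.Adj (.inr 0) (.inl ⟨w 0, hw.ne 0⟩) <;>
  by_cases o1 : C.Adj (.inr 1) (.inl ⟨w 1, hw.ne 1⟩) <;>
  by_cases o2 : C.Adj (.inr 2) (.inl ⟨w 2, hw.ne 2⟩) <;>
  by_cases t01 : C.Adj (.inr 0) (.inr 1) <;>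
  by_cases t02 : C.Adj (.inr 0) (.inr 2) <;>
  by_cases t12 : C.Adj (.inr 1) (.inr 2) <;>
  simp only [o0, o1, o2, t01, t02, t12, if_true, if_false] at e0 e1 e2 ⊢ <;>
  omega

/-- Even subgraphs are used instead of cycles because contraction visibly preserves them. If the
contracted graph stays in fibres, so does `C`, since edges of the triangle project to a single
vertex. -/
theorem heavy_trunc [Fintype V] [Fintype {x // x ≠ v}] {L : ℕ} {π : V → B} {y : V → V → ℕ}
    {r : Fin 3 → ℕ} (hw : HasNeighbors G v w) (hG : ∀ x, ∃ u, HasNeighbors G x u)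
    (hr : ∀ i j, i ≠ j → y v (w i) + y v (w j) ≤ 2 * r i + 2 * r j + 2)
    (hheavy : ∀ C ≤ G, HasEvenDegrees C → L ≤ dartWeight C y ∨ ∀ u v, C.Adj u v → π u = π v)
    (hC : C ≤ truncGraph G v w) (hev : HasEvenDegrees C) :
    L ≤ dartWeight C (truncDemand y v r) ∨
      ∀ s t, C.Adj s t → π (truncProj v s) = π (truncProj v t) := by
  classical
  have hinst : ‹Fintype {x // x ≠ v}› = Subtype.fintype _ := Subsingleton.elim _ _
  subst hinst
  obtain ⟨hcev, hcorner⟩ := contract_corner_aux hw hC hev hr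
  have hev' : HasEvenDegrees (contract v C) := by
    intro x
    by_cases hx : x = v
    · subst hx
      convert hcev
    · have h := sum_old hw hC ⟨x, hx⟩ (hG x) fun _ => 1
      have h' := hev (.inl ⟨x, hx⟩)
      rw [← h] at h'
      exact h'
  rcases hheavy _ (contract_le hw hC) hev' with h | h
  · left
    refine h.trans ?_
    unfold dartWeight
    rw [Fintype.sum_eq_add_sum_subtype_ne _ v, Fintype.sum_sum_type, add_comm]
    refine add_le_add (le_of_eq ?_) hcorner
    refine Finset.sum_congr rfl fun x _ => ?_
    exact sum_old hw hC x (hG x) fun z => 1 + y x z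
  · right
    intro s t hst
    by_cases hne : truncProj v s = truncProj v t
    · rw [hne]
    · exact h _ _ ⟨hne, s, t, rfl, rfl, hst⟩

/-- The final fibre sizes do not change: the triangle has three vertices and one truncation fewer
remains, so 3 + 2∑rᵢ = 1 + 2ρ(v). The new corners have ladder demands, directed along the edges that
leave the triangle. -/
theorem TruncationPlan.trunc [Fintype V] [Fintype {x // x ≠ v}] {K L : ℕ} {π : V → B}
    {y : V → V → ℕ} {ρ : V → ℕ} {r : Fin 3 → ℕ} (h : TruncationPlan K L G π y ρ)
    (hd : IsSplitDemand G y ρ v w r) :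
    TruncationPlan K L (truncGraph G v w) (π ∘ truncProj v) (truncDemand y v r)
      (Sum.elim (fun x => ρ x) r) where
  threeConnected := isThreeConnected_truncGraph h.threeConnected hd.1
  drawing := by
    obtain ⟨pt, hpt⟩ := h.drawing
    exact hpt.exists_truncGraph hd.1
  surjective := h.surjective.comp (truncProj_surjective v)
  fibre_le := by
    classical
    intro b
    refine le_trans (le_of_eq ?_) (h.fibre_le b)
    have hinst : ‹Fintype {x // x ≠ v}› = Subtype.fintype _ := Subsingleton.elim _ _
    subst hinst
    rw [Fintype.sum_eq_add_sum_subtype_ne _ v, Fintype.sum_sum_type, add_comm]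
    congr 1
    · have h1 := hd.2.1
      rw [Fin.sum_univ_three] at h1 ⊢
      by_cases hb : π v = b
      · simp only [Function.comp, truncProj_inr, Sum.elim_inr, hb, if_true]
        omega
      · simp [hb]
  heavy := fun _ hC hev => heavy_trunc hd.1 h.exists_hasNeighbors hd.2.2 h.heavy hC hev
  demand := by
    rintro (x | i)
    · rcases h.demand x with ⟨u, m, hu, hy⟩ | ⟨u, s, hu, hs, hy⟩
      · refine Or.inl ⟨_, m, hasNeighbors_inl hd.1 x hu, fun i => ?_⟩
        simp only [truncDemand, truncProj_liftNeighbor, Sum.elim_inl, hy]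
      · refine Or.inr ⟨_, s, hasNeighbors_inl hd.1 x hu, hs, fun i j hij => ?_⟩
        simp only [truncDemand, truncProj_liftNeighbor]
        exact hy i j hij
    · refine Or.inl ⟨_, 0, hasNeighbors_corner hd.1 i, fun j => ?_⟩
      fin_cases j <;> simp [cornerNeighbors, truncDemand]

/-- Carrying out a plan. -/
theorem TruncationPlan.exists_complete {K L : ℕ} (N : ℕ) :
    ∀ (V : Type) [Fintype V] (G : SimpleGraph V) (π : V → B) (y : V → V → ℕ) (ρ : V → ℕ),
      TruncationPlan K L G π y ρ → ∑ x, ρ x = N →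
      ∃ (V' : Type) (_ : Fintype V') (G' : SimpleGraph V') (π' : V' → B) (y' : V' → V' → ℕ),
        TruncationPlan K L G' π' y' 0 := by
  classical
  induction N with
  | zero =>
    intro V _ G π y ρ h hρ
    have : ρ = 0 := by
      funext x
      exact (Finset.sum_eq_zero_iff.1 hρ) x (Finset.mem_univ x)
    exact ⟨V, inferInstance, G, π, y, this ▸ h⟩
  | succ N ih =>
    intro V _ G π y ρ h hρ
    obtain ⟨v, hv⟩ : ∃ v, ρ v ≠ 0 := by
      by_contra! hall
      simp [hall] at hρ
    obtain ⟨w, r, hd⟩ : ∃ w r, IsSplitDemand G y ρ v w r := by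
      rcases h.demand v with h' | h'
      · exact h'.exists_isSplitDemand hv
      · exact h'
    refine ih _ _ _ _ _ (h.trunc hd) ?_
    rw [Fintype.sum_eq_add_sum_subtype_ne _ v, ← hd.2.1] at hρ
    rw [Fintype.sum_sum_type]
    simp only [Sum.elim_inl, Sum.elim_inr]
    omega

end Stage

/-! ### Cycles of the fully truncated graph. -/

section Complete

variable {B V : Type} {G : SimpleGraph V}

/-- The graph formed by the edges of a walk. -/
def walkGraph {v : V} (c : G.Walk v v) : SimpleGraph V where
  Adj a b := c.toSubgraph.Adj a b
  symm := ⟨fun _ _ h => h.symm⟩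
  loopless := ⟨fun _ h => h.ne rfl⟩

theorem walkGraph_le {v : V} (c : G.Walk v v) : walkGraph c ≤ G := fun _ _ h => h.adj_sub

theorem map_eq_of_mem_support {π : V → B} {u v a : V} (c : G.Walk u v)
    (h : ∀ a b, s(a, b) ∈ c.edges → π a = π b) (ha : a ∈ c.support) : π a = π u := by
  induction c with
  | nil => simp_all
  | @cons u w v hadj p ih =>
    rw [SimpleGraph.Walk.support_cons, List.mem_cons] at ha
    rcases ha with rfl | ha
    · rfl
    · rw [ih (fun a b hab => h a b (by simp [hab])) ha]
      exact (h u w (by simp)).symm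

variable [Fintype V]

open Classical in
theorem sum_walkGraph {v : V} {c : G.Walk v v} (hc : c.IsCycle) (a : V) :
    (∑ x, if (walkGraph c).Adj a x then 1 else 0) = if a ∈ c.support then 2 else 0 := by
  rw [← Finset.card_filter]
  have hset : ((Finset.univ.filter fun x => (walkGraph c).Adj a x : Finset V) : Set V)
      = c.toSubgraph.neighborSet a := by
    ext x
    rw [Finset.mem_coe, Finset.mem_filter]
    exact ⟨fun h => h.2, fun h => ⟨Finset.mem_univ x, h⟩⟩
  rw [← Set.ncard_coe_finset, hset]
  split_ifs with h
  · exact hc.ncard_neighborSet_toSubgraph_eq_two h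
  · rw [Set.ncard_eq_zero]
    ext x
    simp only [SimpleGraph.Subgraph.mem_neighborSet, Set.mem_empty_iff_false, iff_false]
    intro hx
    exact h ((SimpleGraph.Walk.mem_verts_toSubgraph c).1 hx.fst_mem)

/-- The edges of a cycle form an even subgraph. Once no truncation remains, all demands along edges
vanish, so its weight counts every vertex of the cycle twice. A cycle that is not heavy lies in one
fibre, whose size is at most `K`. -/
theorem TruncationPlan.cycle_length {K L : ℕ} {π : V → B} {y : V → V → ℕ}
    (h : TruncationPlan K (2 * L) G π y 0) {v : V} {c : G.Walk v v} (hc : c.IsCycle) :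
    L ≤ c.length ∨ (c.length ≤ K ∧ ∀ a b, s(a, b) ∈ c.edges → π a = π b) := by
  classical
  have hy : ∀ a b, G.Adj a b → y a b = 0 := by
    intro a b hab
    rcases h.demand a with ⟨w, m, hw, hy⟩ | ⟨w, r, _, hr, _⟩
    · obtain ⟨i, rfl⟩ := (hw.adj_iff b).1 hab
      simp [hy]
    -- A split demand needs at least one remaining truncation.
    · exact absurd hr (by simp)
  have hlen : c.support.tail.length = c.length := by simp
  rcases h.heavy (walkGraph c) (walkGraph_le c) (by
      intro a
      rw [sum_walkGraph hc]
      split_ifs <;> simp) with hL | hin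
  · left
    have h1 : dartWeight (walkGraph c) y = 2 * c.support.toFinset.card := by
      unfold dartWeight
      have : ∀ a, (∑ x, if (walkGraph c).Adj a x then 1 + y a x else 0)
          = if a ∈ c.support then 2 else 0 := by
        intro a
        rw [← sum_walkGraph hc a]
        refine Finset.sum_congr rfl fun x _ => ?_
        split_ifs with hax
        · rw [hy a x (walkGraph_le c hax)]
        · rfl
      simp only [this]
      rw [← Finset.sum_filter, Finset.sum_const, smul_eq_mul, mul_comm]
      congr 2
      ext a
      simp
    have h2 : c.support.toFinset ⊆ c.support.tail.toFinset := by
      intro a ha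
      rw [List.mem_toFinset] at ha ⊢
      rw [← SimpleGraph.Walk.cons_tail_support] at ha
      rcases List.mem_cons.1 ha with rfl | ha
      · exact SimpleGraph.Walk.end_mem_tail_support hc.not_nil
      · exact ha
    have h3 := (Finset.card_le_card h2).trans (List.toFinset_card_le _)
    omega
  · right
    have hin' : ∀ a b, s(a, b) ∈ c.edges → π a = π b := fun a b hab =>
      hin a b ((SimpleGraph.Walk.adj_toSubgraph_iff_mem_edges).2 hab)
    refine ⟨?_, hin'⟩
    have h1 : c.support.tail.toFinset ⊆ Finset.univ.filter fun x => π x = π v := by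
      intro a ha
      rw [List.mem_toFinset] at ha
      simp only [Finset.mem_filter, Finset.mem_univ, true_and]
      exact map_eq_of_mem_support c hin' (List.mem_of_mem_tail ha)
    have h2 := Finset.card_le_card h1
    rw [List.toFinset_card_of_nodup hc.support_nodup, hlen] at h2
    refine h2.trans (le_trans (le_of_eq ?_) (h.fibre_le (π v)))
    rw [Finset.card_filter]
    refine Finset.sum_congr rfl fun x _ => ?_
    simp

/-- Another neighbour of `x` is joined to `z` in the graph without `x`, which bypasses the edge. -/
theorem not_isBridge_of_isThreeConnected (hG : IsThreeConnected G)
    (hcub : ∀ v, ∃ w, HasNeighbors G v w) {x z : V} (hxz : G.Adj x z) : ¬ G.IsBridge s(x, z) := by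
  classical
  obtain ⟨w, hw⟩ := hcub x
  obtain ⟨i, rfl⟩ := (hw.adj_iff z).1 hxz
  obtain ⟨j, hj⟩ : ∃ j, j ≠ i := exists_ne i
  have key : Linked G {x} (w j) (w i) :=
    Linked.of_connected (by simpa using hG.2 {x} (by simp)) (by simpa using hw.ne j)
      (by simpa using hw.ne i)
  have hreach : (G \ SimpleGraph.fromEdgeSet {s(x, w i)}).Reachable (w j) (w i) := by
    refine key.induction (P := fun a b =>
      (G \ SimpleGraph.fromEdgeSet {s(x, w i)}).Reachable a b) (fun _ _ => .refl _) ?_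
    intro a b c ha hb hab hbc
    refine SimpleGraph.Reachable.trans (SimpleGraph.Adj.reachable ?_) hbc
    simp only [Finset.mem_singleton] at ha hb
    simp [hab, ha, hb]
  intro hb
  rw [SimpleGraph.isBridge_iff] at hb
  apply hb
  refine SimpleGraph.Reachable.trans (SimpleGraph.Adj.reachable ?_) hreach
  simp [hw.adj j, hw.inj.eq_iff, hj, (hw.ne j)]

/-- Connectedness yields an edge between two fibres. A cycle through it does not lie in one fibre
and so falls under the long alternative. -/
theorem TruncationPlan.exists_long_cycle [Nontrivial B] {K L : ℕ} {π : V → B} {y : V → V → ℕ}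
    (h : TruncationPlan K (2 * L) G π y 0) : ∃ l ∈ cycleSpectrum G, L ≤ l := by
  classical
  obtain ⟨a, b, hab, hne⟩ : ∃ a b, G.Adj a b ∧ π a ≠ π b := by
    by_contra! hall
    obtain ⟨b₁, b₂, hb⟩ := exists_pair_ne B
    obtain ⟨a₁, rfl⟩ := h.surjective b₁
    obtain ⟨a₂, rfl⟩ := h.surjective b₂
    have hl : Linked G ∅ a₁ a₂ :=
      Linked.of_connected (h.threeConnected.2 ∅ (by simp)) (by simp) (by simp)
    exact hb (hl.induction (P := fun a b => π a = π b) (fun _ _ => rfl)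
      fun a b c _ _ hab hbc => (hall a b hab).trans hbc)
  have hbr := not_isBridge_of_isThreeConnected h.threeConnected h.exists_hasNeighbors hab
  rw [SimpleGraph.isBridge_iff_forall_cycle_notMem hab] at hbr
  push Not at hbr
  obtain ⟨u, c, hc, hmem⟩ := hbr
  refine ⟨c.length, ⟨u, c, hc, rfl⟩, ?_⟩
  rcases h.cycle_length hc with h' | h'
  · exact h'
  · exact absurd (h'.2 a b hmem) hne

/-- The properties of a counterexample to Merker's conjecture. -/
def IsCounterexample (k : ℕ) {V : Type} [Fintype V] (G : SimpleGraph V) : Prop :=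
  IsThreeConnected G ∧ IsCubic G ∧ IsPlanar G ∧ (k : ℕ∞) ≤ circumference G ∧
    cycleSpectrum G ∩ Set.Icc k (2 * k + 2) = ∅

theorem TruncationPlan.isCounterexample [Nontrivial B] {k : ℕ} {π : V → B} {y : V → V → ℕ}
    (hk : 0 < k) (h : TruncationPlan (k - 1) (2 * (2 * k + 3)) G π y 0) :
    IsCounterexample k G := by
  refine ⟨h.threeConnected, isCubic_of_hasNeighbors h.exists_hasNeighbors, ?_, ?_, ?_⟩
  · obtain ⟨pt, hpt⟩ := h.drawing
    exact isPlanar_of_isStraightDrawing hpt h.exists_hasNeighbors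
  · obtain ⟨l, hl, hkl⟩ := h.exists_long_cycle
    refine le_trans ?_ (le_iSup₂ (f := fun l (_ : l ∈ cycleSpectrum G) => (l : ℕ∞)) l hl)
    exact_mod_cast (by omega : k ≤ l)
  · rw [Set.eq_empty_iff_forall_notMem]
    rintro _ ⟨⟨v, c, hc, rfl⟩, h1, h2⟩
    rcases h.cycle_length hc with h' | ⟨h', _⟩ <;> omega

end Complete

/-! ### The tube graph and its 3-connectedness. -/

/-- The eight kinds of vertices of the tube graph, from the innermost to the outermost ring. -/
inductive TubeKind
  | a | b | c | d | e | f | g | h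
  deriving DecidableEq

open TubeKind

instance : Fintype TubeKind where
  elems := {a, b, c, d, e, f, g, h}
  complete := by
    intro κ
    cases κ <;> decide

theorem TubeKind.card : Fintype.card TubeKind = 8 := rfl

/-- The three neighbours of a vertex of the tube graph; the first one lies on another ring. -/
def tubeNeighbor {n : ℕ} : TubeKind × ZMod n → Fin 3 → TubeKind × ZMod n
  | (a, i) => ![(b, i), (a, i + 1), (a, i - 1)]
  | (b, i) => ![(a, i), (c, i), (c, i - 1)]
  | (c, i) => ![(d, i), (b, i), (b, i + 1)]
  | (d, i) => ![(c, i), (e, i), (e, i + 1)]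
  | (e, i) => ![(f, i), (d, i), (d, i - 1)]
  | (f, i) => ![(e, i), (g, i), (g, i - 1)]
  | (g, i) => ![(h, i), (f, i), (f, i + 1)]
  | (h, i) => ![(g, i), (h, i + 1), (h, i - 1)]

/-- The ring that contains the vertices of a given kind. -/
def TubeKind.ring : TubeKind → ℕ
  | a => 0
  | b => 1
  | c => 1
  | d => 2
  | e => 2
  | f => 3
  | g => 3
  | h => 4

/-- Two `n`-gons, joined by a tube made of a ring of `n` pentagons, two rings of `n` hexagons and
another ring of `n` pentagons. -/
def tubeGraph (n : ℕ) : SimpleGraph (TubeKind × ZMod n) where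
  Adj u v := u ≠ v ∧ ∃ j, tubeNeighbor u j = v
  symm := ⟨by
    rintro ⟨κ, i⟩ v ⟨hne, j, rfl⟩
    refine ⟨hne.symm, ?_⟩
    cases κ <;> fin_cases j <;> simp [tubeNeighbor, Fin.exists_fin_succ]⟩
  loopless := ⟨fun _ h => h.1 rfl⟩

section Tube

variable {n : ℕ}

theorem ZMod.one_ne_zero_of_three_le (hn : 3 ≤ n) : (1 : ZMod n) ≠ 0 := by
  have := (ZMod.natCast_eq_zero_iff 1 n).not.2 (fun h => by have := Nat.le_of_dvd one_pos h; omega)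
  simpa using this

theorem ZMod.two_ne_zero_of_three_le (hn : 3 ≤ n) : (2 : ZMod n) ≠ 0 := by
  have := (ZMod.natCast_eq_zero_iff 2 n).not.2 (fun h => by have := Nat.le_of_dvd two_pos h; omega)
  simpa using this

theorem ZMod.add_one_ne_sub_one (hn : 3 ≤ n) (i : ZMod n) : i + 1 ≠ i - 1 := by
  intro h
  apply ZMod.two_ne_zero_of_three_le hn
  linear_combination h

theorem ZMod.ne_sub_one (hn : 3 ≤ n) (i : ZMod n) : i ≠ i - 1 := by
  intro h
  apply ZMod.one_ne_zero_of_three_le hn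
  linear_combination h

theorem hasNeighbors_tubeGraph (hn : 3 ≤ n) (v : TubeKind × ZMod n) :
    HasNeighbors (tubeGraph n) v (tubeNeighbor v) where
  inj := by
    have h1 := ZMod.one_ne_zero_of_three_le hn
    obtain ⟨κ, i⟩ := v
    have h2 := ZMod.add_one_ne_sub_one hn i
    have h3 := ZMod.ne_sub_one hn i
    intro j l
    cases κ <;> fin_cases j <;> fin_cases l <;> simp [tubeNeighbor, h1, h2, h2.symm, h3, h3.symm]
  adj_iff := by
    have h1 := ZMod.one_ne_zero_of_three_le hn
    intro x
    constructor
    · exact fun h => h.2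
    · rintro ⟨j, rfl⟩
      refine ⟨?_, j, rfl⟩
      obtain ⟨κ, i⟩ := v
      have h2 := ZMod.ne_sub_one hn i
      cases κ <;> fin_cases j <;> simp [tubeNeighbor, h1, h2]

theorem tubeGraph_adj (hn : 3 ≤ n) (v : TubeKind × ZMod n) (j : Fin 3) :
    (tubeGraph n).Adj v (tubeNeighbor v j) := (hasNeighbors_tubeGraph hn v).adj j

variable {S : Finset (TubeKind × ZMod n)}

theorem Linked.of_tubeNeighbor (hn : 3 ≤ n) {u v : TubeKind × ZMod n} (j : Fin 3) (hu : u ∉ S)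
    (hv : v ∉ S) (h : tubeNeighbor u j = v) : Linked (tubeGraph n) S u v :=
  Linked.of_adj (h ▸ tubeGraph_adj hn u j) hu hv

theorem linked_column (hn : 3 ≤ n) {i : ZMod n} (hi : ∀ v ∈ S, v.2 ≠ i) (κ : TubeKind) :
    Linked (tubeGraph n) S (κ, i) (a, i) := by
  have hS : ∀ κ, (κ, i) ∉ S := fun κ h => hi _ h rfl
  have hab : Linked (tubeGraph n) S (b, i) (a, i) := .of_tubeNeighbor hn 0 (hS _) (hS _) rfl
  have hbc : Linked (tubeGraph n) S (c, i) (b, i) := .of_tubeNeighbor hn 1 (hS _) (hS _) rfl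
  have hcd : Linked (tubeGraph n) S (d, i) (c, i) := .of_tubeNeighbor hn 0 (hS _) (hS _) rfl
  have hde : Linked (tubeGraph n) S (e, i) (d, i) := .of_tubeNeighbor hn 1 (hS _) (hS _) rfl
  have hef : Linked (tubeGraph n) S (f, i) (e, i) := .of_tubeNeighbor hn 0 (hS _) (hS _) rfl
  have hfg : Linked (tubeGraph n) S (g, i) (f, i) := .of_tubeNeighbor hn 1 (hS _) (hS _) rfl
  have hgh : Linked (tubeGraph n) S (h, i) (g, i) := .of_tubeNeighbor hn 0 (hS _) (hS _) rfl
  have hc := hbc.trans hab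
  have hd := hcd.trans hc
  have he := hde.trans hd
  have hf := hef.trans he
  have hg := hfg.trans hf
  cases κ
  exacts [.refl (hS a), hab, hc, hd, he, hf, hg, hgh.trans hg]

theorem linked_ring_succ (hn : 3 ≤ n) {κ : TubeKind} (hκ : ∀ v ∈ S, v.1.ring ≠ κ.ring)
    (i : ZMod n) : Linked (tubeGraph n) S (κ, i) (κ, i + 1) := by
  have hS : ∀ κ' : TubeKind, κ'.ring = κ.ring → ∀ i, (κ', i) ∉ S := fun κ' h i hi =>
    hκ _ hi h
  have hκS := hS κ rfl
  cases κ
  · exact .of_tubeNeighbor hn 1 (hκS _) (hκS _) rfl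
  · exact .trans (.of_tubeNeighbor hn 1 (hκS _) (hS c rfl i) rfl)
      (.of_tubeNeighbor hn 2 (hS c rfl i) (hκS _) rfl)
  · exact .trans (.of_tubeNeighbor hn 2 (hκS _) (hS b rfl (i + 1)) rfl)
      (.of_tubeNeighbor hn 1 (hS b rfl (i + 1)) (hκS _) rfl)
  · exact .trans (.of_tubeNeighbor hn 2 (hκS _) (hS e rfl (i + 1)) rfl)
      (.of_tubeNeighbor hn 1 (hS e rfl (i + 1)) (hκS _) rfl)
  · exact .trans (.of_tubeNeighbor hn 1 (hκS _) (hS d rfl i) rfl)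
      (.of_tubeNeighbor hn 2 (hS d rfl i) (hκS _) rfl)
  · exact .trans (.of_tubeNeighbor hn 1 (hκS _) (hS g rfl i) rfl)
      (.symm (.of_tubeNeighbor hn 2 (hκS _) (hS g rfl i) (by simp [tubeNeighbor])))
  · exact .trans (.of_tubeNeighbor hn 2 (hκS _) (hS f rfl (i + 1)) rfl)
      (.of_tubeNeighbor hn 1 (hS f rfl (i + 1)) (hκS _) rfl)
  · exact .of_tubeNeighbor hn 1 (hκS _) (hκS _) rfl

theorem ZMod.forall_of_succ [NeZero n] {P : ZMod n → Prop} (hP : ∀ i, P i → P (i + 1))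
    {i : ZMod n} (hi : P i) (j : ZMod n) : P j := by
  have key : ∀ m : ℕ, P (i + m) := by
    intro m
    induction m with
    | zero => simpa using hi
    | succ m ih =>
      have := hP _ ih
      rwa [add_assoc, ← Nat.cast_succ] at this
  have := key (j - i).val
  rwa [ZMod.natCast_zmod_val, add_sub_cancel] at this

theorem linked_ring (hn : 3 ≤ n) {κ : TubeKind} (hκ : ∀ v ∈ S, v.1.ring ≠ κ.ring)
    (i j : ZMod n) : Linked (tubeGraph n) S (κ, i) (κ, j) := by
  have : NeZero n := ⟨by omega⟩
  exact ZMod.forall_of_succ (P := fun j => Linked (tubeGraph n) S (κ, i) (κ, j))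
    (fun j hj => hj.trans (linked_ring_succ hn hκ j)) (.refl fun h => hκ _ h rfl) j

/-- On the three middle rings the radial edges alternately point inwards and outwards. If both the
own ring and the one across the radial edge are hit, these two hits exhaust `S`. Some ring neighbour
is then free, and its radial edge leads to the ring on the other side, which is untouched. -/
theorem linked_good_ring_of_inner (hn : 3 ≤ n) (hS : S.card < 3) {v : TubeKind × ZMod n}
    (hv : v ∉ S) (hva : v.1 ≠ a) (hvh : v.1 ≠ h) :
    ∃ u, Linked (tubeGraph n) S v u ∧ ∀ s ∈ S, s.1.ring ≠ u.1.ring := by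
  by_cases hgood : ∀ s ∈ S, s.1.ring ≠ v.1.ring
  · exact ⟨v, .refl hv, hgood⟩
  push Not at hgood
  obtain ⟨s, hs, hsv⟩ := hgood
  obtain ⟨r0, r1, r2, r10, r20, r10', r20'⟩ :
      (tubeNeighbor v 0).1.ring ≠ v.1.ring ∧ (tubeNeighbor v 1).1.ring = v.1.ring ∧
      (tubeNeighbor v 2).1.ring = v.1.ring ∧
      (tubeNeighbor (tubeNeighbor v 1) 0).1.ring ≠ v.1.ring ∧
      (tubeNeighbor (tubeNeighbor v 2) 0).1.ring ≠ v.1.ring ∧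
      (tubeNeighbor (tubeNeighbor v 1) 0).1.ring ≠ (tubeNeighbor v 0).1.ring ∧
      (tubeNeighbor (tubeNeighbor v 2) 0).1.ring ≠ (tubeNeighbor v 0).1.ring := by
    obtain ⟨κ, i⟩ := v
    cases κ <;> simp_all [tubeNeighbor, TubeKind.ring]
  by_cases hgood0 : ∀ s ∈ S, s.1.ring ≠ (tubeNeighbor v 0).1.ring
  · exact ⟨_, .of_tubeNeighbor hn 0 hv (fun h => hgood0 _ h rfl) rfl, hgood0⟩
  push Not at hgood0
  obtain ⟨t, ht, htv⟩ := hgood0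
  have hst : s ≠ t := by
    rintro rfl
    exact r0 (htv.symm.trans hsv)
  have hcover : ∀ x ∈ S, x = s ∨ x = t := by
    intro x hx
    by_contra! hne
    have := Finset.two_lt_card.2 ⟨x, hx, s, hs, t, ht, hne.1, hne.2, hst⟩
    omega
  have h12 : tubeNeighbor v 1 ≠ tubeNeighbor v 2 := fun h => by
    simpa using (hasNeighbors_tubeGraph hn v).inj h
  have step : ∀ j : Fin 3, tubeNeighbor v j ≠ s → (tubeNeighbor v j).1.ring = v.1.ring →
      (tubeNeighbor (tubeNeighbor v j) 0).1.ring ≠ v.1.ring →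
      (tubeNeighbor (tubeNeighbor v j) 0).1.ring ≠ (tubeNeighbor v 0).1.ring →
      ∃ u, Linked (tubeGraph n) S v u ∧ ∀ s ∈ S, s.1.ring ≠ u.1.ring := by
    intro j hjs hj hj1 hj2
    have hjS : tubeNeighbor v j ∉ S := by
      intro h
      rcases hcover _ h with h | h
      · exact hjs h
      · exact r0 (by rw [← htv, ← h, hj])
    have hgood : ∀ s ∈ S, s.1.ring ≠ (tubeNeighbor (tubeNeighbor v j) 0).1.ring := by
      intro x hx
      rcases hcover x hx with rfl | rfl
      · rw [hsv]; exact hj1.symm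
      · rw [htv]; exact hj2.symm
    exact ⟨_, .trans (.of_tubeNeighbor hn j hv hjS rfl)
      (.of_tubeNeighbor hn 0 hjS (fun h => hgood _ h rfl) rfl), hgood⟩
  by_cases h1 : tubeNeighbor v 1 = s
  · exact step 2 (fun h => h12 (h1.trans h.symm)) r2 r20 r20'
  · exact step 1 h1 r1 r10 r10'

/-- On the innermost and outermost rings, either the radial neighbour or that of a ring neighbour is
free, which reduces the claim to the middle rings. -/
theorem linked_good_ring (hn : 3 ≤ n) (hS : S.card < 3) {v : TubeKind × ZMod n} (hv : v ∉ S) :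
    ∃ u, Linked (tubeGraph n) S v u ∧ ∀ s ∈ S, s.1.ring ≠ u.1.ring := by
  by_cases hin : v.1 ≠ a ∧ v.1 ≠ h
  · exact linked_good_ring_of_inner hn hS hv hin.1 hin.2
  by_cases hgood : ∀ s ∈ S, s.1.ring ≠ v.1.ring
  · exact ⟨v, .refl hv, hgood⟩
  push Not at hgood
  obtain ⟨s, hs, hsv⟩ := hgood
  have via : ∀ x, Linked (tubeGraph n) S v x → x.1 ≠ a → x.1 ≠ h →
      ∃ u, Linked (tubeGraph n) S v u ∧ ∀ s ∈ S, s.1.ring ≠ u.1.ring := by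
    intro x hx hxa hxh
    obtain ⟨u, hu, hu'⟩ := linked_good_ring_of_inner hn hS hx.notMem_right hxa hxh
    exact ⟨u, hx.trans hu, hu'⟩
  have h1 := ZMod.one_ne_zero_of_three_le hn
  obtain ⟨ka, kh, r0, r1, r2, ne1, ne2, ka1, kh1, ka2, kh2, r10, r20⟩ :
      (tubeNeighbor v 0).1 ≠ a ∧ (tubeNeighbor v 0).1 ≠ h ∧
      (tubeNeighbor v 0).1.ring ≠ v.1.ring ∧ (tubeNeighbor v 1).1.ring = v.1.ring ∧
      (tubeNeighbor v 2).1.ring = v.1.ring ∧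
      tubeNeighbor (tubeNeighbor v 1) 0 ≠ tubeNeighbor v 0 ∧
      tubeNeighbor (tubeNeighbor v 2) 0 ≠ tubeNeighbor v 0 ∧
      (tubeNeighbor (tubeNeighbor v 1) 0).1 ≠ a ∧ (tubeNeighbor (tubeNeighbor v 1) 0).1 ≠ h ∧
      (tubeNeighbor (tubeNeighbor v 2) 0).1 ≠ a ∧ (tubeNeighbor (tubeNeighbor v 2) 0).1 ≠ h ∧
      (tubeNeighbor (tubeNeighbor v 1) 0).1.ring ≠ v.1.ring ∧
      (tubeNeighbor (tubeNeighbor v 2) 0).1.ring ≠ v.1.ring := by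
    obtain ⟨κ, i⟩ := v
    cases κ <;> simp_all [tubeNeighbor, TubeKind.ring]
  by_cases h0 : tubeNeighbor v 0 ∈ S
  · have hst : s ≠ tubeNeighbor v 0 := by
      rintro rfl
      exact r0 hsv
    have hcover : ∀ x ∈ S, x = s ∨ x = tubeNeighbor v 0 := by
      intro x hx
      by_contra! hne
      have := Finset.two_lt_card.2 ⟨x, hx, s, hs, _, h0, hne.1, hne.2, hst⟩
      omega
    have h12 : tubeNeighbor v 1 ≠ tubeNeighbor v 2 := fun h => by
      simpa using (hasNeighbors_tubeGraph hn v).inj h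
    have step : ∀ j : Fin 3, tubeNeighbor v j ≠ s → (tubeNeighbor v j).1.ring = v.1.ring →
        tubeNeighbor (tubeNeighbor v j) 0 ≠ tubeNeighbor v 0 →
        (tubeNeighbor (tubeNeighbor v j) 0).1.ring ≠ v.1.ring →
        Linked (tubeGraph n) S v (tubeNeighbor (tubeNeighbor v j) 0) := by
      intro j hjs hj hj0 hjr
      have hjS : tubeNeighbor v j ∉ S := by
        intro h
        rcases hcover _ h with h | h
        · exact hjs h
        · exact r0 (by rw [← h, hj])
      have hjS' : tubeNeighbor (tubeNeighbor v j) 0 ∉ S := by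
        intro h
        rcases hcover _ h with h | h
        · exact hjr (by rw [h, hsv])
        · exact hj0 h
      exact .trans (.of_tubeNeighbor hn j hv hjS rfl) (.of_tubeNeighbor hn 0 hjS hjS' rfl)
    by_cases h1 : tubeNeighbor v 1 = s
    · exact via _ (step 2 (fun h => h12 (h1.trans h.symm)) r2 ne2 r20) ka2 kh2
    · exact via _ (step 1 h1 r1 ne1 r10) ka1 kh1
  · exact via _ (.of_tubeNeighbor hn 0 hv h0 rfl) ka kh

/-- Since n ≥ 3, some column misses `S`. Every surviving vertex reaches a ring that misses `S`,
follows it to that column and runs down the column. -/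
theorem isThreeConnected_tubeGraph [NeZero n] (hn : 3 ≤ n) : IsThreeConnected (tubeGraph n) := by
  refine ⟨?_, fun S hS => ?_⟩
  · rw [Fintype.card_prod, ZMod.card, TubeKind.card]
    omega
  obtain ⟨i, hi⟩ : ∃ i : ZMod n, i ∉ S.image Prod.snd := by
    by_contra! hall
    have h1 : (S.image Prod.snd).card = n := by
      rw [Finset.eq_univ_iff_forall.2 hall, Finset.card_univ, ZMod.card]
    have h2 : (S.image Prod.snd).card ≤ S.card := Finset.card_image_le
    omega
  have hi' : ∀ v ∈ S, v.2 ≠ i := fun v hv h => hi (h ▸ Finset.mem_image_of_mem _ hv)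
  refine Linked.connected (b := (a, i)) (fun h => hi' _ h rfl) fun v hv => ?_
  obtain ⟨⟨κ, j⟩, hu, hu'⟩ := linked_good_ring hn hS hv
  exact (hu.trans (linked_ring hn hu' j i)).trans (linked_column hn hi' κ)

end Tube

/-! ### Weights of even subgraphs of the tube graph. -/

/-- The contribution of the directed edge from a vertex of kind `κ` to its `j`-th neighbour to
the weight of a subgraph of the tube graph. -/
def tubeWeight (p : ℕ) : TubeKind → Fin 3 → ℕ
  | c => ![2 * p, 4, 2]
  | f => ![2 * p, 4, 2]
  | _ => ![2 * p + 2, 2, 2]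

/-- The demand on the directed edges of the tube graph. -/
def tubeDemand {n : ℕ} (p : ℕ) (u v : TubeKind × ZMod n) : ℕ :=
  if v = tubeNeighbor u 0 then tubeWeight p u.1 0 - 1
  else if v = tubeNeighbor u 1 then tubeWeight p u.1 1 - 1 else tubeWeight p u.1 2 - 1

section TubeWeight

variable {n p : ℕ}

theorem one_add_tubeDemand (hn : 3 ≤ n) (hp : 1 ≤ p) (u : TubeKind × ZMod n) (j : Fin 3) :
    1 + tubeDemand p u (tubeNeighbor u j) = tubeWeight p u.1 j := by
  have hinj := (hasNeighbors_tubeGraph hn u).inj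
  have h1 : tubeNeighbor u 1 ≠ tubeNeighbor u 0 := fun h => by simpa using hinj h
  have h2 : tubeNeighbor u 2 ≠ tubeNeighbor u 0 := fun h => by simpa using hinj h
  have h3 : tubeNeighbor u 2 ≠ tubeNeighbor u 1 := fun h => by simpa using hinj h
  obtain ⟨κ, i⟩ := u
  fin_cases j
  · cases κ <;> simp [tubeDemand, tubeWeight] <;> omega
  · simp only [tubeDemand, Fin.mk_one, h1, if_true, if_false]
    cases κ <;> simp [tubeWeight]
  · simp only [tubeDemand, Fin.reduceFinMk, h2, h3, if_false]
    cases κ <;> simp [tubeWeight]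

/-- Usually all p truncations after the first serve the radial port. At kinds `c` and `f` one of
them is diverted to a ring port: a passage along the ring then costs 3 instead of 2, and a radial
turn costs p + 2 or only p + 1. Pentagons have one such vertex to make up for the missing sixth
vertex; the hexagons in the two middle layers can afford the cheap turn. -/
theorem tube_isSplitDemand (hn : 3 ≤ n) (hp : 1 ≤ p) (u : TubeKind × ZMod n) :
    ∃ w r, IsSplitDemand (tubeGraph n) (tubeDemand p) (fun _ => p + 1) u w r := by
  have key : ∃ r : Fin 3 → ℕ, ∑ i, r i + 1 = p + 1 ∧ ∀ i j, i ≠ j →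
      tubeWeight p u.1 i + tubeWeight p u.1 j ≤ 2 * r i + 2 * r j + 4 := by
    obtain ⟨κ, i⟩ := u
    by_cases hκ : κ = c ∨ κ = f
    · refine ⟨![p - 1, 1, 0], by simp [Fin.sum_univ_three]; omega, ?_⟩
      intro i j
      rcases hκ with rfl | rfl <;> fin_cases i <;> fin_cases j <;> simp [tubeWeight] <;> omega
    · refine ⟨![p, 0, 0], by simp [Fin.sum_univ_three], ?_⟩
      intro i j
      cases κ <;> simp at hκ <;> fin_cases i <;> fin_cases j <;> simp [tubeWeight] <;> omega
  obtain ⟨r, hr, hr'⟩ := key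
  refine ⟨_, r, hasNeighbors_tubeGraph hn u, hr, fun i j hij => ?_⟩
  have h1 := one_add_tubeDemand hn hp u i
  have h2 := one_add_tubeDemand hn hp u j
  have := hr' i j hij
  omega

variable {C : SimpleGraph (TubeKind × ZMod n)}

open Classical in
/-- The contribution of `u` to the weight of `C`. -/
noncomputable def localWeight (p : ℕ) (C : SimpleGraph (TubeKind × ZMod n))
    (u : TubeKind × ZMod n) : ℕ :=
  ∑ j, if C.Adj u (tubeNeighbor u j) then tubeWeight p u.1 j else 0

theorem dartWeight_eq [NeZero n] (hn : 3 ≤ n) (hp : 1 ≤ p) (hC : C ≤ tubeGraph n) :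
    dartWeight C (tubeDemand p) = ∑ u, localWeight p C u := by
  classical
  refine Finset.sum_congr rfl fun u _ => ?_
  rw [(hasNeighbors_tubeGraph hn u).sum_ite hC]
  simp only [one_add_tubeDemand hn hp]
  rfl

/-- The number of neighbours in `C` is zero or two. -/
theorem adj_cases [NeZero n] (hn : 3 ≤ n) (hC : C ≤ tubeGraph n) (hev : HasEvenDegrees C)
    (u : TubeKind × ZMod n) :
    (∀ j, ¬ C.Adj u (tubeNeighbor u j)) ∨
    (C.Adj u (tubeNeighbor u 0) ∧ C.Adj u (tubeNeighbor u 1) ∧ ¬ C.Adj u (tubeNeighbor u 2)) ∨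
    (C.Adj u (tubeNeighbor u 0) ∧ ¬ C.Adj u (tubeNeighbor u 1) ∧ C.Adj u (tubeNeighbor u 2)) ∨
    (¬ C.Adj u (tubeNeighbor u 0) ∧ C.Adj u (tubeNeighbor u 1) ∧ C.Adj u (tubeNeighbor u 2)) := by
  classical
  have h := hev u
  rw [(hasNeighbors_tubeGraph hn u).sum_ite hC, Fin.sum_univ_three, Nat.even_iff] at h
  rw [Fin.forall_fin_succ, Fin.forall_fin_succ, Fin.forall_fin_one]
  by_cases h0 : C.Adj u (tubeNeighbor u 0) <;> by_cases h1 : C.Adj u (tubeNeighbor u 1) <;>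
    by_cases h2 : C.Adj u (tubeNeighbor u 2) <;> simp [h0, h1, h2] at h ⊢

theorem adj_ring_of_adj [NeZero n] (hn : 3 ≤ n) (hC : C ≤ tubeGraph n) (hev : HasEvenDegrees C)
    {u v : TubeKind × ZMod n} (hvu : C.Adj v u) (h0 : ¬ C.Adj u (tubeNeighbor u 0)) :
    C.Adj u (tubeNeighbor u 1) ∧ C.Adj u (tubeNeighbor u 2) := by
  obtain ⟨j, rfl⟩ := (hC hvu.symm).2
  rcases adj_cases hn hC hev u with h | h | h | h
  · exact absurd hvu.symm (h j)
  · exact absurd h.1 h0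
  · exact absurd h.1 h0
  · exact h.2

theorem localWeight_eq (u : TubeKind × ZMod n) [Decidable (C.Adj u (tubeNeighbor u 0))]
    [Decidable (C.Adj u (tubeNeighbor u 1))] [Decidable (C.Adj u (tubeNeighbor u 2))] :
    localWeight p C u = (if C.Adj u (tubeNeighbor u 0) then tubeWeight p u.1 0 else 0) +
      (if C.Adj u (tubeNeighbor u 1) then tubeWeight p u.1 1 else 0) +
      (if C.Adj u (tubeNeighbor u 2) then tubeWeight p u.1 2 else 0) := by
  unfold localWeight
  rw [Fin.sum_univ_three]
  congr

theorem tubeNeighbor_tubeNeighbor_zero (u : TubeKind × ZMod n) :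
    tubeNeighbor (tubeNeighbor u 0) 0 = u := by
  obtain ⟨κ, i⟩ := u
  cases κ <;> rfl

theorem le_localWeight_of_adj_zero [NeZero n] (hn : 3 ≤ n) (hC : C ≤ tubeGraph n)
    (hev : HasEvenDegrees C) {u : TubeKind × ZMod n} (h0 : C.Adj u (tubeNeighbor u 0)) :
    tubeWeight p u.1 0 + 2 ≤ localWeight p C u ∧
      (C.Adj u (tubeNeighbor u 1) → tubeWeight p u.1 0 + tubeWeight p u.1 1 ≤ localWeight p C u) ∧
      (C.Adj u (tubeNeighbor u 1) ∨ C.Adj u (tubeNeighbor u 2)) := by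
  classical
  have h1 : 2 ≤ tubeWeight p u.1 1 := by cases u.1 <;> simp [tubeWeight]
  have h2 : 2 ≤ tubeWeight p u.1 2 := by cases u.1 <;> simp [tubeWeight]
  rw [localWeight_eq]
  rcases adj_cases hn hC hev u with h | h | h | h
  · exact absurd h0 (h 0)
  · simp [h, h1]
  · simp [h, h2]
  · exact absurd h0 h.1

theorem le_localWeight_of_adj_ring {u : TubeKind × ZMod n}
    (h : C.Adj u (tubeNeighbor u 1) ∧ C.Adj u (tubeNeighbor u 2)) :
    tubeWeight p u.1 1 + tubeWeight p u.1 2 ≤ localWeight p C u := by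
  classical
  rw [localWeight_eq]
  simp [h]

/-- The later bounds list distinct vertices of `C` and add up their contributions. -/
theorem list_sum_le [NeZero n] (l : List (TubeKind × ZMod n)) (hl : l.Nodup) :
    (l.map (localWeight p C)).sum ≤ ∑ u, localWeight p C u := by
  rw [← List.sum_toFinset _ hl]
  exact Finset.sum_le_sum_of_subset (Finset.subset_univ _)

/-- Many edges between rings. -/
theorem weight_of_many [NeZero n] (hn : 3 ≤ n) (hC : C ≤ tubeGraph n) (hev : HasEvenDegrees C)
    (T : Finset (TubeKind × ZMod n)) (hT : ∀ u ∈ T, C.Adj u (tubeNeighbor u 0)) :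
    T.card * (4 * p + 6) ≤ 2 * ∑ u, localWeight p C u := by
  have hinv : Function.Involutive fun u : TubeKind × ZMod n => tubeNeighbor u 0 :=
    tubeNeighbor_tubeNeighbor_zero
  have h1 : ∑ u, localWeight p C (tubeNeighbor u 0) = ∑ u, localWeight p C u :=
    Equiv.sum_comp hinv.toPerm (localWeight p C)
  have h2 : 2 * ∑ u, localWeight p C u
      = ∑ u, (localWeight p C u + localWeight p C (tubeNeighbor u 0)) := by
    rw [Finset.sum_add_distrib, h1, two_mul]
  rw [h2, ← smul_eq_mul, ← Finset.sum_const]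
  refine (Finset.sum_le_sum fun u hu => ?_).trans
    (Finset.sum_le_sum_of_subset (Finset.subset_univ T))
  have h3 := (le_localWeight_of_adj_zero (p := p) hn hC hev (hT u hu)).1
  have h4 := (le_localWeight_of_adj_zero (p := p) (u := tubeNeighbor u 0) hn hC hev (by
    rw [tubeNeighbor_tubeNeighbor_zero]; exact (hT u hu).symm)).1
  -- Equality holds for the radial edges that have an end of kind `c` or `f` on the tube's middle
  -- layers.
  have h5 : 4 * p + 2 ≤ tubeWeight p u.1 0 + tubeWeight p (tubeNeighbor u 0).1 0 := by
    obtain ⟨κ, i⟩ := u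
    cases κ <;> simp [tubeNeighbor, tubeWeight] <;> omega
  omega

/-- No edges between rings. -/
theorem weight_of_none [NeZero n] (hn : 3 ≤ n) (hC : C ≤ tubeGraph n) (hev : HasEvenDegrees C)
    (hT : ∀ u, ¬ C.Adj u (tubeNeighbor u 0)) {u v : TubeKind × ZMod n} (huv : C.Adj u v) :
    4 * n ≤ ∑ u, localWeight p C u := by
  obtain ⟨κ, i⟩ := v
  have hring : ∀ {u v : TubeKind × ZMod n}, C.Adj u v →
      C.Adj v (tubeNeighbor v 1) ∧ C.Adj v (tubeNeighbor v 2) := fun h =>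
    adj_ring_of_adj hn hC hev h (hT _)
  have hsucc : ∀ i, (∃ u, C.Adj u (κ, i)) → ∃ u, C.Adj u (κ, i + 1) := by
    rintro i ⟨u, hu⟩
    cases κ
    · exact ⟨_, (hring hu).1⟩
    · exact ⟨_, (hring (hring hu).1).2⟩
    · exact ⟨_, (hring (hring hu).2).1⟩
    · exact ⟨_, (hring (hring hu).2).1⟩
    · exact ⟨_, (hring (hring hu).1).2⟩
    · have h1 : C.Adj (f, i) (g, i) := (hring hu).1
      exact ⟨_, (hring h1).2⟩
    · exact ⟨_, (hring (hring hu).2).1⟩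
    · exact ⟨_, (hring hu).1⟩
  have hall := ZMod.forall_of_succ hsucc ⟨u, huv⟩
  have h4 : ∀ j, 4 ≤ localWeight p C (κ, j) := by
    intro j
    obtain ⟨u, hu⟩ := hall j
    refine le_trans ?_ (le_localWeight_of_adj_ring (hring hu))
    cases κ <;> simp [tubeWeight]
  calc 4 * n = ∑ j : ZMod n, 4 := by simp [mul_comm]
    _ ≤ ∑ j : ZMod n, localWeight p C (κ, j) := Finset.sum_le_sum fun j _ => h4 j
    _ ≤ ∑ κ, ∑ j : ZMod n, localWeight p C (κ, j) :=
        Finset.single_le_sum (f := fun κ => ∑ j : ZMod n, localWeight p C (κ, j))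
          (fun _ _ => Nat.zero_le _) (Finset.mem_univ κ)
    _ = ∑ u, localWeight p C u := (Fintype.sum_prod_type _).symm

/-- The part of `C` in the rings up to `r`. -/
def innerPart (C : SimpleGraph (TubeKind × ZMod n)) (r : ℕ) :
    SimpleGraph (TubeKind × ZMod n) where
  Adj u v := C.Adj u v ∧ u.1.ring ≤ r ∧ v.1.ring ≤ r
  symm := ⟨fun _ _ h => ⟨h.1.symm, h.2.2, h.2.1⟩⟩
  loopless := ⟨fun _ h => h.1.ne rfl⟩

/-- The number of edges of `C` between two consecutive rings is not one. -/
theorem exists_second_crossing [NeZero n] (hn : 3 ≤ n) (hC : C ≤ tubeGraph n)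
    (hev : HasEvenDegrees C) {κ : TubeKind} (hκ : κ = a ∨ κ = c ∨ κ = e ∨ κ = g) {i : ZMod n}
    (hi : C.Adj (κ, i) (tubeNeighbor (κ, i) 0)) :
    ∃ j, j ≠ i ∧ C.Adj (κ, j) (tubeNeighbor (κ, j) 0) := by
  classical
  by_contra! hall
  have hle : innerPart C κ.ring ≤ C := fun _ _ h => h.1
  -- Cutting off the outer rings lowers the degree only at the inner ends of crossing edges. A
  -- single crossing would leave exactly one vertex of odd degree, against the handshake lemma.
  have hdeg : ∀ u, Odd ((innerPart C κ.ring).degree u) ↔ u = (κ, i) := by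
    intro u
    have h1 : (innerPart C κ.ring).degree u
        = ∑ x, if (innerPart C κ.ring).Adj u x then 1 else 0 := by
      rw [← SimpleGraph.card_neighborFinset_eq_degree, SimpleGraph.neighborFinset_eq_filter,
        Finset.card_filter]
    rw [h1, (hasNeighbors_tubeGraph hn u).sum_ite (hle.trans hC), Fin.sum_univ_three]
    by_cases hu : u.1.ring ≤ κ.ring
    · have r1 : (tubeNeighbor u 1).1.ring = u.1.ring := by
        obtain ⟨κ, i⟩ := u
        cases κ <;> rfl
      have r2 : (tubeNeighbor u 2).1.ring = u.1.ring := by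
        obtain ⟨κ, i⟩ := u
        cases κ <;> rfl
      have r0 : (tubeNeighbor u 0).1.ring ≤ κ.ring ↔ u.1 ≠ κ := by
        obtain ⟨κ', i⟩ := u
        rcases hκ with rfl | rfl | rfl | rfl <;> cases κ' <;>
          simp_all [TubeKind.ring, tubeNeighbor]
      simp only [innerPart, hu, r1, r2, r0, true_and, and_true]
      by_cases huκ : u.1 = κ
      · have hui : u = (κ, i) ↔ C.Adj u (tubeNeighbor u 0) := by
          constructor
          · rintro rfl
            exact hi
          · intro h
            obtain ⟨κ', j⟩ := u
            have huκ : κ' = κ := huκ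
            subst huκ
            by_contra hne
            exact hall j (fun hj => hne (by rw [hj])) h
        rw [hui]
        rcases adj_cases hn hC hev u with h | h | h | h <;> simp [h, huκ]
      · have hui : u ≠ (κ, i) := fun h => huκ (by rw [h])
        rcases adj_cases hn hC hev u with h | h | h | h <;> simp [h, huκ, hui]
    · have hui : u ≠ (κ, i) := by
        rintro rfl
        exact hu le_rfl
      simp [innerPart, hu, hui]
  have := (innerPart C κ.ring).even_card_odd_degree_vertices
  simp only [hdeg] at this
  rw [Finset.filter_eq' Finset.univ] at this
  simp at this

end TubeWeight

section TubeWeight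

variable {n p : ℕ} {C : SimpleGraph (TubeKind × ZMod n)}

/-- The four ends of the radial edges contribute at least 2p + 4 each. The subgraph leaves `(b, i)`
along the ring and must run straight through a vertex of kind `c`, which adds 6: exactly a pentagon.
-/
theorem weight_of_two_ab [NeZero n] (hn : 3 ≤ n) (hC : C ≤ tubeGraph n) (hev : HasEvenDegrees C)
    {i j : ZMod n} (hij : i ≠ j) (hi : C.Adj (a, i) (b, i)) (hj : C.Adj (a, j) (b, j))
    (hT : ∀ u, C.Adj u (tubeNeighbor u 0) → u.1 = a ∨ u.1 = b) :
    8 * p + 22 ≤ ∑ u, localWeight p C u := by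
  have wai := (le_localWeight_of_adj_zero (p := p) (u := (a, i)) hn hC hev hi).1
  have waj := (le_localWeight_of_adj_zero (p := p) (u := (a, j)) hn hC hev hj).1
  obtain ⟨wbi, -, hb⟩ := le_localWeight_of_adj_zero (p := p) (u := (b, i)) hn hC hev hi.symm
  have wbj := (le_localWeight_of_adj_zero (p := p) (u := (b, j)) hn hC hev hj.symm).1
  obtain ⟨l, hl⟩ : ∃ l, C.Adj (b, i) (c, l) := by
    rcases hb with hb | hb
    exacts [⟨_, hb⟩, ⟨_, hb⟩]
  have wc := le_localWeight_of_adj_ring (p := p)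
    (adj_ring_of_adj hn hC hev hl fun h => by simpa using hT _ h)
  have hsum := list_sum_le (p := p) (C := C) [(a, i), (a, j), (b, i), (b, j), (c, l)]
    (by simp [hij])
  simp [tubeWeight] at *
  omega

/-- Mirror image of `weight_of_two_ab`, with `f` in the role of `c`. -/
theorem weight_of_two_gh [NeZero n] (hn : 3 ≤ n) (hC : C ≤ tubeGraph n) (hev : HasEvenDegrees C)
    {i j : ZMod n} (hij : i ≠ j) (hi : C.Adj (g, i) (h, i)) (hj : C.Adj (g, j) (h, j))
    (hT : ∀ u, C.Adj u (tubeNeighbor u 0) → u.1 = g ∨ u.1 = h) :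
    8 * p + 22 ≤ ∑ u, localWeight p C u := by
  have whi := (le_localWeight_of_adj_zero (p := p) (u := (h, i)) hn hC hev hi.symm).1
  have whj := (le_localWeight_of_adj_zero (p := p) (u := (h, j)) hn hC hev hj.symm).1
  obtain ⟨wgi, -, hg⟩ := le_localWeight_of_adj_zero (p := p) (u := (g, i)) hn hC hev hi
  have wgj := (le_localWeight_of_adj_zero (p := p) (u := (g, j)) hn hC hev hj).1
  obtain ⟨l, hl⟩ : ∃ l, C.Adj (g, i) (f, l) := by
    rcases hg with hg | hg
    exacts [⟨_, hg⟩, ⟨_, hg⟩]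
  have wf := le_localWeight_of_adj_ring (p := p)
    (adj_ring_of_adj hn hC hev hl fun h => by simpa using hT _ h)
  have hsum := list_sum_le (p := p) (C := C) [(g, i), (g, j), (h, i), (h, j), (f, l)]
    (by simp [hij])
  simp [tubeWeight] at *
  omega

/-- The ends and one vertex of kind `e` give 8p + 16, counting both turns at `c` as cheap; 6 more
are needed. If the subgraph leaves `(c, i)` by the dear side, that turn adds 2 and the next `b` adds
4. If it leaves by the cheap side, it passes `(b, i + 1)` and reaches `(c, i + 1)` from the dear
side: this is either the other turn, adding 2, or a straight passage, adding 6. -/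
theorem weight_of_two_cd [NeZero n] (hn : 3 ≤ n) (hC : C ≤ tubeGraph n) (hev : HasEvenDegrees C)
    {i j : ZMod n} (hij : i ≠ j) (hi : C.Adj (c, i) (d, i)) (hj : C.Adj (c, j) (d, j))
    (hT : ∀ u, C.Adj u (tubeNeighbor u 0) → (u.1 = c ∨ u.1 = d) ∧ (u.2 = i ∨ u.2 = j)) :
    8 * p + 22 ≤ ∑ u, localWeight p C u := by
  obtain ⟨wdi, -, hd⟩ := le_localWeight_of_adj_zero (p := p) (u := (d, i)) hn hC hev hi.symm
  have wdj := (le_localWeight_of_adj_zero (p := p) (u := (d, j)) hn hC hev hj.symm).1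
  obtain ⟨l, hl⟩ : ∃ l, C.Adj (d, i) (e, l) := by
    rcases hd with hd | hd
    exacts [⟨_, hd⟩, ⟨_, hd⟩]
  have we := le_localWeight_of_adj_ring (p := p)
    (adj_ring_of_adj hn hC hev hl fun h => by simpa using (hT _ h).1)
  obtain ⟨wci, wci', hc⟩ := le_localWeight_of_adj_zero (p := p) (u := (c, i)) hn hC hev hi
  obtain ⟨wcj, wcj', -⟩ := le_localWeight_of_adj_zero (p := p) (u := (c, j)) hn hC hev hj
  have hb : ∀ {m}, C.Adj (c, i) (b, m) → 4 ≤ localWeight p C (b, m) ∧ C.Adj (b, m) (c, m) := by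
    intro m hm
    have hm' := adj_ring_of_adj hn hC hev hm fun h => by simpa using (hT _ h).1
    exact ⟨le_localWeight_of_adj_ring (p := p) hm', hm'.1⟩
  rcases hc with hc | hc
  · have wb := (hb hc).1
    have wci := wci' hc
    have hsum := list_sum_le (p := p) (C := C) [(c, i), (c, j), (d, i), (d, j), (e, l), (b, i)]
      (by simp [hij])
    simp [tubeWeight] at *
    omega
  · obtain ⟨wb, hbc⟩ := hb hc
    by_cases hj1 : i + 1 = j
    · subst hj1
      have wcj := wcj' hbc.symm
      have hsum := list_sum_le (p := p) (C := C)
        [(c, i), (c, i + 1), (d, i), (d, i + 1), (e, l), (b, i + 1)] (by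
          simp [ZMod.one_ne_zero_of_three_le hn])
      simp [tubeWeight] at *
      omega
    · have hne : i ≠ i + 1 := fun h => ZMod.one_ne_zero_of_three_le hn (by simpa using h.symm)
      have wc := le_localWeight_of_adj_ring (p := p) (adj_ring_of_adj hn hC hev hbc fun h => by
        rcases (hT _ h).2 with h | h
        · exact hne h.symm
        · exact hj1 h)
      have hsum := list_sum_le (p := p) (C := C)
        [(c, i), (c, j), (d, i), (d, j), (e, l), (b, i + 1), (c, i + 1)] (by
          simp [hij, hne, Ne.symm hj1])
      simp [tubeWeight] at *
      omega

/-- As in `weight_of_two_cd`, with `f` in place of `c`; the cheap side of `f` now points backwards,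
hence `i - 1`. -/
theorem weight_of_two_ef [NeZero n] (hn : 3 ≤ n) (hC : C ≤ tubeGraph n) (hev : HasEvenDegrees C)
    {i j : ZMod n} (hij : i ≠ j) (hi : C.Adj (e, i) (f, i)) (hj : C.Adj (e, j) (f, j))
    (hT : ∀ u, C.Adj u (tubeNeighbor u 0) → (u.1 = e ∨ u.1 = f) ∧ (u.2 = i ∨ u.2 = j)) :
    8 * p + 22 ≤ ∑ u, localWeight p C u := by
  obtain ⟨wei, -, he⟩ := le_localWeight_of_adj_zero (p := p) (u := (e, i)) hn hC hev hi
  have wej := (le_localWeight_of_adj_zero (p := p) (u := (e, j)) hn hC hev hj).1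
  obtain ⟨l, hl⟩ : ∃ l, C.Adj (e, i) (d, l) := by
    rcases he with he | he
    exacts [⟨_, he⟩, ⟨_, he⟩]
  have wd := le_localWeight_of_adj_ring (p := p)
    (adj_ring_of_adj hn hC hev hl fun h => by simpa using (hT _ h).1)
  obtain ⟨wfi, wfi', hf⟩ := le_localWeight_of_adj_zero (p := p) (u := (f, i)) hn hC hev hi.symm
  obtain ⟨wfj, wfj', -⟩ := le_localWeight_of_adj_zero (p := p) (u := (f, j)) hn hC hev hj.symm
  have hg : ∀ {m}, C.Adj (f, i) (g, m) →
      4 ≤ localWeight p C (g, m) ∧ C.Adj (g, m) (f, m) := by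
    intro m hm
    have hm' := adj_ring_of_adj hn hC hev hm fun h => by simpa using (hT _ h).1
    exact ⟨le_localWeight_of_adj_ring (p := p) hm', hm'.1⟩
  rcases hf with hf | hf
  · have wg := (hg hf).1
    have wfi := wfi' hf
    have hsum := list_sum_le (p := p) (C := C) [(f, i), (f, j), (e, i), (e, j), (d, l), (g, i)]
      (by simp [hij])
    simp [tubeWeight] at *
    omega
  · obtain ⟨wg, hgf⟩ := hg hf
    have hne : i ≠ i - 1 := ZMod.ne_sub_one hn i
    by_cases hj1 : i - 1 = j
    · subst hj1
      have wfj := wfj' hgf.symm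
      have hsum := list_sum_le (p := p) (C := C)
        [(f, i), (f, i - 1), (e, i), (e, i - 1), (d, l), (g, i - 1)] (by simp [hne])
      simp [tubeWeight] at *
      omega
    · have wf := le_localWeight_of_adj_ring (p := p) (adj_ring_of_adj hn hC hev hgf fun h => by
        rcases (hT _ h).2 with h | h
        · exact hne h.symm
        · exact hj1 h)
      have hsum := list_sum_le (p := p) (C := C)
        [(f, i), (f, j), (e, i), (e, j), (d, l), (g, i - 1), (f, i - 1)] (by
          simp [hij, hne, Ne.symm hj1])
      simp [tubeWeight] at *
      omega

/-- Every nonempty subgraph of the tube graph with even degrees is heavy. -/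
theorem heavy_tubeGraph [NeZero n] (hn : 3 ≤ n) (hp : 1 ≤ p) (hpn : 2 * p + 6 ≤ n)
    (hC : C ≤ tubeGraph n) (hev : HasEvenDegrees C) {u v : TubeKind × ZMod n}
    (huv : C.Adj u v) : 8 * p + 22 ≤ dartWeight C (tubeDemand p) := by
  classical
  rw [dartWeight_eq hn hp hC]
  by_cases hnone : ∀ u, ¬ C.Adj u (tubeNeighbor u 0)
  · have := weight_of_none (p := p) hn hC hev hnone huv
    omega
  push Not at hnone
  obtain ⟨κ, i, hκ, hi⟩ : ∃ κ i, (κ = a ∨ κ = c ∨ κ = e ∨ κ = g) ∧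
      C.Adj (κ, i) (tubeNeighbor (κ, i) 0) := by
    obtain ⟨⟨κ, i⟩, hu⟩ := hnone
    cases κ
    exacts [⟨a, i, by simp, hu⟩, ⟨a, i, by simp, hu.symm⟩, ⟨c, i, by simp, hu⟩,
      ⟨c, i, by simp, hu.symm⟩, ⟨e, i, by simp, hu⟩, ⟨e, i, by simp, hu.symm⟩,
      ⟨g, i, by simp, hu⟩, ⟨g, i, by simp, hu.symm⟩]
  obtain ⟨j, hji, hj⟩ := exists_second_crossing hn hC hev hκ hi
  have hi' : C.Adj (tubeNeighbor (κ, i) 0) (tubeNeighbor (tubeNeighbor (κ, i) 0) 0) := by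
    rw [tubeNeighbor_tubeNeighbor_zero]; exact hi.symm
  have hj' : C.Adj (tubeNeighbor (κ, j) 0) (tubeNeighbor (tubeNeighbor (κ, j) 0) 0) := by
    rw [tubeNeighbor_tubeNeighbor_zero]; exact hj.symm
  -- The four ends of the two crossings found. Any further crossing adds two new ends, and six ends
  -- give weight at least 3(4p + 6).
  set T : Finset (TubeKind × ZMod n) :=
    {(κ, i), tubeNeighbor (κ, i) 0, (κ, j), tubeNeighbor (κ, j) 0} with hT
  have hTcard : T.card = 4 := by
    rw [hT]
    rcases hκ with rfl | rfl | rfl | rfl <;>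
      simp [tubeNeighbor, Finset.card_insert_of_notMem, hji.symm]
  have hTC : ∀ u ∈ T, C.Adj u (tubeNeighbor u 0) := by
    intro u hu
    simp only [hT, Finset.mem_insert, Finset.mem_singleton] at hu
    rcases hu with rfl | rfl | rfl | rfl <;> assumption
  have hTinv : ∀ u, tubeNeighbor u 0 ∈ T → u ∈ T := by
    intro u hu
    rw [← tubeNeighbor_tubeNeighbor_zero u]
    generalize tubeNeighbor u 0 = x at hu ⊢
    simp only [hT, Finset.mem_insert, Finset.mem_singleton] at hu ⊢
    rcases hu with rfl | rfl | rfl | rfl <;> simp [tubeNeighbor_tubeNeighbor_zero]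
  by_cases hmore : ∃ x, x ∉ T ∧ C.Adj x (tubeNeighbor x 0)
  · obtain ⟨x, hxT, hx⟩ := hmore
    have hx' : tubeNeighbor x 0 ∉ T := fun h => hxT (hTinv x h)
    have hcard : (insert (tubeNeighbor x 0) (insert x T)).card = 6 := by
      rw [Finset.card_insert_of_notMem, Finset.card_insert_of_notMem hxT, hTcard]
      rw [Finset.mem_insert, not_or]
      exact ⟨(tubeGraph_adj hn x 0).ne', hx'⟩
    have := weight_of_many (p := p) hn hC hev (insert (tubeNeighbor x 0) (insert x T)) (by
      intro u hu
      rcases Finset.mem_insert.1 hu with rfl | hu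
      · rw [tubeNeighbor_tubeNeighbor_zero]; exact hx.symm
      rcases Finset.mem_insert.1 hu with rfl | hu
      · exact hx
      · exact hTC u hu)
    rw [hcard] at this
    omega
  · push Not at hmore
    have hmem : ∀ u, C.Adj u (tubeNeighbor u 0) → u ∈ T := fun u hu => by
      by_contra h
      exact hmore u h hu
    simp only [hT, Finset.mem_insert, Finset.mem_singleton] at hmem
    rcases hκ with rfl | rfl | rfl | rfl
    · refine weight_of_two_ab hn hC hev hji.symm hi hj fun u hu => ?_
      rcases hmem u hu with rfl | rfl | rfl | rfl <;> simp [tubeNeighbor]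
    · refine weight_of_two_cd hn hC hev hji.symm hi hj fun u hu => ?_
      rcases hmem u hu with rfl | rfl | rfl | rfl <;> simp [tubeNeighbor]
    · refine weight_of_two_ef hn hC hev hji.symm hi hj fun u hu => ?_
      rcases hmem u hu with rfl | rfl | rfl | rfl <;> simp [tubeNeighbor]
    · refine weight_of_two_gh hn hC hev hji.symm hi hj fun u hu => ?_
      rcases hmem u hu with rfl | rfl | rfl | rfl <;> simp [tubeNeighbor]

end TubeWeight

/-! ### A straight-line drawing of the tube graph on concentric circles. -/

section Polar

variable {n : ℕ}

/-- The unit complex number whose argument is `t` times `π / n`. -/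
noncomputable def unitPoint (n : ℕ) (t : ℝ) : ℂ := Complex.exp ((t * (Real.pi / n) : ℝ) * Complex.I)

theorem norm_unitPoint (t : ℝ) : ‖unitPoint n t‖ = 1 := Complex.norm_exp_ofReal_mul_I _

theorem unitPoint_add (s t : ℝ) : unitPoint n (s + t) = unitPoint n s * unitPoint n t := by
  rw [unitPoint, unitPoint, unitPoint, ← Complex.exp_add]
  congr 1
  push_cast
  ring

theorem unitPoint_eq_iff [NeZero n] {s t : ℝ} :
    unitPoint n s = unitPoint n t ↔ ∃ m : ℤ, s = t + m * (2 * n) := by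
  have hn : (n : ℝ) ≠ 0 := Nat.cast_ne_zero.2 (NeZero.ne n)
  have hpi := Real.pi_ne_zero
  rw [unitPoint, unitPoint, Complex.exp_eq_exp_iff_exists_int]
  refine exists_congr fun m => ?_
  have h1 : ((s * (Real.pi / n) : ℝ) : ℂ) * Complex.I
      = ((t * (Real.pi / n) : ℝ) : ℂ) * Complex.I + m * (2 * Real.pi * Complex.I) ↔
      s * (Real.pi / n) = t * (Real.pi / n) + m * (2 * Real.pi) := by
    constructor
    · intro h
      rw [← Complex.ofReal_inj]
      apply mul_right_cancel₀ Complex.I_ne_zero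
      rw [h]
      push_cast
      ring
    · intro h
      rw [h]
      push_cast
      ring
  rw [h1]
  constructor
  · intro h
    field_simp at h
    linear_combination h
  · intro h
    rw [h]
    field_simp

theorem eq_of_mul_unitPoint_eq [NeZero n] {ρ ρ' s t : ℝ} (hρ : 0 < ρ) (hρ' : 0 < ρ')
    (h : (ρ : ℂ) * unitPoint n s = ρ' * unitPoint n t) :
    ρ = ρ' ∧ ∃ m : ℤ, s = t + m * (2 * n) := by
  have h1 : ρ = ρ' := by
    have := congrArg norm h
    rwa [norm_mul, norm_mul, norm_unitPoint, norm_unitPoint, mul_one, mul_one, Complex.norm_real,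
      Complex.norm_real, Real.norm_of_nonneg hρ.le, Real.norm_of_nonneg hρ'.le] at this
  refine ⟨h1, unitPoint_eq_iff.1 ?_⟩
  rw [h1] at h
  exact mul_left_cancel₀ (Complex.ofReal_ne_zero.2 hρ'.ne') h

/-- Polar coordinates of the points of a chord. -/
theorem exists_polar_of_mem_chord (hn : 3 ≤ n) {R s d : ℝ} {z : ℂ} (hR : 0 < R) (hd : 0 < d)
    (hd2 : d ≤ 2) (hz : z ∈ segment ℝ (R * unitPoint n s) (R * unitPoint n (s + d))) :
    ∃ ρ t : ℝ, z = ρ * unitPoint n t ∧ s ≤ t ∧ t ≤ s + d ∧ R / 2 ≤ ρ ∧ ρ ≤ R ∧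
      (t = s → z = R * unitPoint n s) ∧ (t = s + d → z = R * unitPoint n (s + d)) := by
  have hn' : (3 : ℝ) ≤ n := by exact_mod_cast hn
  have hpi := Real.pi_pos
  set α : ℝ := Real.pi / n with hα
  have hα0 : 0 < α := by positivity
  have hα3 : α ≤ Real.pi / 3 := by
    rw [hα]
    gcongr
  set δ : ℝ := d / 2 * α with hδ
  have hδ0 : 0 < δ := by positivity
  have hδα : δ ≤ α := by
    rw [hδ]
    nlinarith
  have hcos : 1 / 2 ≤ Real.cos δ := by
    rw [← Real.cos_pi_div_three]
    exact Real.cos_le_cos_of_nonneg_of_le_pi hδ0.le (by linarith) (by linarith)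
  rw [segment_eq_image] at hz
  obtain ⟨x, ⟨hx0, hx1⟩, hx⟩ := hz
  -- The angle measured from the middle of the chord: the foot of the perpendicular has distance R
  -- cos δ, so the radius is R cos δ / cos φ. As δ ≤ π/3, it never drops below R/2.
  set φ : ℝ := Real.arctan ((2 * x - 1) * Real.tan δ) with hφ
  have htan : 0 ≤ Real.tan δ := Real.tan_nonneg_of_nonneg_of_le_pi_div_two hδ0.le (by linarith)
  have hatan : Real.arctan (Real.tan δ) = δ :=
    Real.arctan_tan (by linarith) (by linarith)
  have hφ1 : φ ≤ δ := by
    rw [← hatan]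
    exact Real.arctan_strictMono.monotone (by nlinarith)
  have hφ2 : -δ ≤ φ := by
    rw [← hatan, ← Real.arctan_neg]
    exact Real.arctan_strictMono.monotone (by nlinarith)
  have hcosφ : Real.cos δ ≤ Real.cos φ := by
    rw [← Real.cos_abs φ]
    exact Real.cos_le_cos_of_nonneg_of_le_pi (abs_nonneg _) (by linarith) (abs_le.2 ⟨hφ2, hφ1⟩)
  have hcosφ0 : 0 < Real.cos φ := by linarith
  have hsinφ : Real.sin φ = (2 * x - 1) * (Real.sin δ / Real.cos δ) * Real.cos φ := by
    rw [← Real.tan_eq_sin_div_cos, ← Real.tan_arctan ((2 * x - 1) * Real.tan δ), ← hφ,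
      Real.tan_mul_cos hcosφ0.ne']
  have unit_eq : ∀ ψ : ℝ, unitPoint n (ψ / α) = Real.cos ψ + Real.sin ψ * Complex.I := by
    intro ψ
    rw [unitPoint, ← hα, div_mul_cancel₀ _ hα0.ne', Complex.exp_mul_I, Complex.ofReal_cos,
      Complex.ofReal_sin]
  have hδα' : δ / α = d / 2 := by rw [hδ]; field_simp
  have e1 : unitPoint n s = unitPoint n (s + d / 2) * unitPoint n (-δ / α) := by
    rw [← unitPoint_add, neg_div, hδα']
    congr 1
    ring
  have e2 : unitPoint n (s + d) = unitPoint n (s + d / 2) * unitPoint n (δ / α) := by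
    rw [← unitPoint_add, hδα']
    congr 1
    ring
  have hz' : z = ((R * Real.cos δ / Real.cos φ : ℝ) : ℂ) * unitPoint n (s + d / 2 + φ / α) := by
    rw [← hx, unitPoint_add (s + d / 2) (φ / α), e1, e2, unit_eq, unit_eq, unit_eq, hsinφ,
      Real.cos_neg, Real.sin_neg]
    simp only [Complex.real_smul]
    have h1 : (Real.cos φ : ℂ) ≠ 0 := Complex.ofReal_ne_zero.2 hcosφ0.ne'
    have h2 : (Real.cos δ : ℂ) ≠ 0 := Complex.ofReal_ne_zero.2 (by linarith : 0 < Real.cos δ).ne'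
    push_cast at h1 h2 ⊢
    field_simp
    ring
  have hφα1 : φ / α ≤ d / 2 := by
    rw [← hδα']
    gcongr
  have hφα2 : -(d / 2) ≤ φ / α := by
    rw [← hδα', ← neg_div]
    gcongr
  refine ⟨_, _, hz', by linarith, by linarith, ?_, ?_, ?_, ?_⟩
  · rw [le_div_iff₀ hcosφ0]
    have := Real.cos_le_one φ
    nlinarith
  · rw [div_le_iff₀ hcosφ0]
    nlinarith
  · intro ht
    have h1 : φ / α = -(δ / α) := by
      rw [hδα']
      linarith
    have h2 : φ = -δ := by
      rw [← neg_div] at h1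
      exact (div_left_inj' hα0.ne').1 h1
    rw [hz', ht, h2, Real.cos_neg, mul_div_assoc, div_self (by linarith : 0 < Real.cos δ).ne',
      mul_one]
  · intro ht
    have h1 : φ / α = δ / α := by
      rw [hδα']
      linarith
    have h2 : φ = δ := (div_left_inj' hα0.ne').1 h1
    rw [hz', ht, h2, mul_div_assoc, div_self (by linarith : 0 < Real.cos δ).ne', mul_one]

theorem exists_polar_of_mem_radius {R R' s : ℝ} {z : ℂ} (hR : R ≤ R')
    (hz : z ∈ segment ℝ (R * unitPoint n s) (R' * unitPoint n s)) :
    ∃ ρ : ℝ, z = ρ * unitPoint n s ∧ R ≤ ρ ∧ ρ ≤ R' := by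
  rw [segment_eq_image'] at hz
  obtain ⟨x, ⟨hx0, hx1⟩, rfl⟩ := hz
  refine ⟨R + x * (R' - R), ?_, by nlinarith, by nlinarith⟩
  simp only [Complex.real_smul]
  push_cast
  ring

end Polar

section TubeDrawing

variable {n : ℕ}

/-- The angular offset of a kind of vertices, in half steps. -/
def TubeKind.offset : TubeKind → ℕ
  | a => 0
  | b => 0
  | c => 1
  | d => 1
  | e => 0
  | f => 0
  | g => 1
  | h => 1

/-- The angular distance between consecutive vertices on the ring of a kind, in half steps. -/
def TubeKind.step : TubeKind → ℕ
  | a => 2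
  | h => 2
  | _ => 1

/-- The next vertex on the same ring. -/
def tubeNext : TubeKind × ZMod n → TubeKind × ZMod n
  | (a, i) => (a, i + 1)
  | (b, i) => (c, i)
  | (c, i) => (b, i + 1)
  | (d, i) => (e, i + 1)
  | (e, i) => (d, i)
  | (f, i) => (g, i)
  | (g, i) => (f, i + 1)
  | (h, i) => (h, i + 1)

/-- The angular position of a vertex, in half steps. -/
def tubePos (u : TubeKind × ZMod n) : ℕ := 2 * u.2.val + u.1.offset

/-- The point of the plane that represents a vertex of the tube graph. -/
noncomputable def tubePoint (u : TubeKind × ZMod n) : ℂ :=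
  ((3 ^ u.1.ring : ℝ) : ℂ) * unitPoint n (tubePos u)

theorem unitPoint_val_add_one [NeZero n] (i : ZMod n) (x : ℝ) :
    unitPoint n (2 * ((i + 1).val : ℝ) + x) = unitPoint n (2 * (i.val : ℝ) + 2 + x) := by
  rw [unitPoint_eq_iff]
  have h : (((i + 1).val : ℤ) : ZMod n) = ((i.val + 1 : ℤ) : ZMod n) := by simp
  rw [ZMod.intCast_eq_intCast_iff] at h
  obtain ⟨m, hm⟩ := h.symm.dvd
  refine ⟨m, ?_⟩
  have hm' : ((i + 1).val : ℝ) - (i.val + 1) = n * m := by exact_mod_cast hm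
  linear_combination 2 * hm'

theorem tubePoint_tubeNext [NeZero n] (u : TubeKind × ZMod n) :
    tubePoint (tubeNext u) = ((3 ^ u.1.ring : ℝ) : ℂ) * unitPoint n (tubePos u + u.1.step) := by
  obtain ⟨κ, i⟩ := u
  have h0 := unitPoint_val_add_one i 0
  cases κ <;> simp only [tubePoint, tubeNext, TubeKind.ring, TubeKind.step, tubePos,
    TubeKind.offset] <;> congr 1 <;> push_cast <;>
    first
      | (rw [unitPoint_val_add_one]; congr 1; ring)
      | (congr 1; ring)

theorem tubePos_lt [NeZero n] (u : TubeKind × ZMod n) : tubePos u < 2 * n := by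
  have h1 := ZMod.val_lt u.2
  have h2 : u.1.offset ≤ 1 := by cases u.1 <;> decide
  unfold tubePos
  omega

theorem tubePos_eq_of_add [NeZero n] {u v : TubeKind × ZMod n} {m : ℤ}
    (h : (tubePos u : ℤ) = tubePos v + m * (2 * n)) : tubePos u = tubePos v := by
  have hu := tubePos_lt u
  have hv := tubePos_lt v
  have hm : m = 0 := by
    by_contra hm
    rcases lt_or_gt_of_ne hm with h' | h'
    · have : m ≤ -1 := by omega
      nlinarith
    · have : 1 ≤ m := by omega
      nlinarith
  subst hm
  omega

theorem eq_of_ring_eq_of_tubePos_eq [NeZero n] {u v : TubeKind × ZMod n}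
    (hr : u.1.ring = v.1.ring) (hp : tubePos u = tubePos v) : u = v := by
  obtain ⟨κ, i⟩ := u
  obtain ⟨κ', j⟩ := v
  simp only [tubePos] at hp
  have hr : κ.ring = κ'.ring := hr
  have ho : κ = κ' := by
    have hmod : κ.offset % 2 = κ'.offset % 2 := by omega
    revert hr hmod
    cases κ <;> cases κ' <;> decide
  subst ho
  rw [ZMod.val_injective n (by omega : i.val = j.val)]

theorem pow_three_pos (r : ℕ) : (0 : ℝ) < 3 ^ r := by positivity

theorem tubePoint_injective [NeZero n] : Function.Injective (tubePoint (n := n)) := by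
  intro u v huv
  obtain ⟨h1, m, hm⟩ := eq_of_mul_unitPoint_eq (pow_three_pos _) (pow_three_pos _) huv
  have hm' : (tubePos u : ℤ) = tubePos v + m * (2 * n) := by exact_mod_cast hm
  exact eq_of_ring_eq_of_tubePos_eq (pow_right_injective₀ (by norm_num) (by norm_num) h1)
    (tubePos_eq_of_add hm')

theorem tube_edge_cases {s : Sym2 (TubeKind × ZMod n)} (hs : s ∈ (tubeGraph n).edgeSet) :
    (∃ u, s = s(u, tubeNext u)) ∨
      ∃ u : TubeKind × ZMod n, (u.1 = a ∨ u.1 = c ∨ u.1 = e ∨ u.1 = g) ∧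
        s = s(u, tubeNeighbor u 0) := by
  induction s using Sym2.ind with
  | _ u v =>
    have hs : (tubeGraph n).Adj u v := hs
    obtain ⟨-, j, rfl⟩ := hs
    by_cases hj : j = 0
    · subst hj
      right
      by_cases hu : u.1 = a ∨ u.1 = c ∨ u.1 = e ∨ u.1 = g
      · exact ⟨u, hu, rfl⟩
      · refine ⟨tubeNeighbor u 0, ?_, by rw [tubeNeighbor_tubeNeighbor_zero, Sym2.eq_swap]⟩
        obtain ⟨κ, i⟩ := u
        cases κ <;> simp [tubeNeighbor] at hu ⊢
    · left
      by_cases h : tubeNext u = tubeNeighbor u j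
      · exact ⟨u, by rw [h]⟩
      · refine ⟨tubeNeighbor u j, ?_⟩
        rw [show tubeNext (tubeNeighbor u j) = u by
          obtain ⟨κ, i⟩ := u
          cases κ <;> fin_cases j <;> simp_all [tubeNeighbor, tubeNext], Sym2.eq_swap]

/-- Polar coordinates on an edge inside a ring. -/
theorem exists_polar_next [NeZero n] (hn : 3 ≤ n) {u : TubeKind × ZMod n} {z : ℂ}
    (hz : z ∈ edgeSegment tubePoint s(u, tubeNext u)) :
    ∃ ρ t : ℝ, z = ρ * unitPoint n t ∧ tubePos u ≤ t ∧ t ≤ tubePos u + u.1.step ∧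
      (3 ^ u.1.ring : ℝ) / 2 ≤ ρ ∧ ρ ≤ 3 ^ u.1.ring ∧ (t = tubePos u → z = tubePoint u) ∧
      (t = tubePos u + u.1.step → z = tubePoint (tubeNext u)) := by
  rw [edgeSegment_mk, tubePoint_tubeNext] at hz
  rw [tubePoint_tubeNext]
  exact exists_polar_of_mem_chord hn (pow_three_pos _)
    (by cases u.1 <;> simp [TubeKind.step]) (by cases u.1 <;> simp [TubeKind.step]) hz

theorem tubePoint_tubeNeighbor_zero {u : TubeKind × ZMod n}
    (hu : u.1 = a ∨ u.1 = c ∨ u.1 = e ∨ u.1 = g) :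
    tubePoint (tubeNeighbor u 0) = ((3 ^ (u.1.ring + 1) : ℝ) : ℂ) * unitPoint n (tubePos u) := by
  obtain ⟨κ, i⟩ := u
  rcases hu with h | h | h | h <;> · simp only at h; subst h; rfl

/-- Polar coordinates on an edge between two rings. -/
theorem exists_polar_crossing {u : TubeKind × ZMod n} {z : ℂ}
    (hu : u.1 = a ∨ u.1 = c ∨ u.1 = e ∨ u.1 = g)
    (hz : z ∈ edgeSegment tubePoint s(u, tubeNeighbor u 0)) :
    ∃ ρ : ℝ, z = ρ * unitPoint n (tubePos u) ∧ (3 ^ u.1.ring : ℝ) ≤ ρ ∧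
      ρ ≤ 3 ^ (u.1.ring + 1) := by
  rw [edgeSegment_mk, tubePoint_tubeNeighbor_zero hu] at hz
  exact exists_polar_of_mem_radius (pow_le_pow_right₀ (by norm_num) (by omega)) hz

/-- The radii grow by the factor 3, more than the factor 2 by which a chord may dip, so chords of
different rings lie in disjoint annuli. -/
theorem ring_le_of_half_pow_le {r r' : ℕ} (h : (3 ^ r : ℝ) / 2 ≤ 3 ^ r') : r ≤ r' := by
  by_contra! hlt
  have h1 : (3 : ℝ) ^ (r' + 1) ≤ 3 ^ r := pow_le_pow_right₀ (by norm_num) hlt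
  have h2 := pow_three_pos r'
  rw [pow_succ] at h1
  linarith

/-- Equal radii force equal rings. There the angular intervals of two chords meet at most at their
ends; on the rings of step 2 this uses that all positions have the same parity. -/
theorem next_inter_next [NeZero n] (hn : 3 ≤ n) {u v : TubeKind × ZMod n} (huv : u ≠ v) {z : ℂ}
    (hzu : z ∈ edgeSegment tubePoint s(u, tubeNext u))
    (hzv : z ∈ edgeSegment tubePoint s(v, tubeNext v)) :
    ∃ t, t ∈ s(u, tubeNext u) ∧ t ∈ s(v, tubeNext v) ∧ tubePoint t = z := by
  obtain ⟨ρ, t, rfl, ht1, ht2, hρ1, hρ2, hs, he⟩ := exists_polar_next hn hzu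
  obtain ⟨ρ', t', hz, ht1', ht2', hρ1', hρ2', hs', he'⟩ := exists_polar_next hn hzv
  have p1 := pow_three_pos u.1.ring
  have p2 := pow_three_pos v.1.ring
  obtain ⟨rfl, m, hm⟩ := eq_of_mul_unitPoint_eq (by linarith) (by linarith) hz
  have hring : u.1.ring = v.1.ring :=
    le_antisymm (ring_le_of_half_pow_le (hρ1.trans hρ2'))
      (ring_le_of_half_pow_le (hρ1'.trans hρ2))
  have hstep : u.1.step = v.1.step ∧ (u.1.step = 1 ∨ u.1.step = 2 ∧ u.1.offset = v.1.offset) := by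
    revert hring
    cases u.1 <;> cases v.1 <;> decide
  obtain ⟨hst, hpar⟩ := hstep
  rw [← hst] at ht2' he'
  have i1 : (tubePos u : ℤ) ≤ tubePos v + m * (2 * n) + u.1.step := by
    have : (tubePos u : ℝ) ≤ tubePos v + m * (2 * n) + u.1.step := by linarith
    exact_mod_cast this
  have i2 : (tubePos v : ℤ) + m * (2 * n) ≤ tubePos u + u.1.step := by
    have : (tubePos v : ℝ) + m * (2 * n) ≤ tubePos u + u.1.step := by linarith
    exact_mod_cast this
  have hcases : (tubePos u : ℤ) = tubePos v + m * (2 * n) ∨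
      (tubePos u : ℤ) = tubePos v + m * (2 * n) + u.1.step ∨
      (tubePos v : ℤ) + m * (2 * n) = tubePos u + u.1.step := by
    rcases hpar with h | ⟨h, ho⟩
    · rw [h] at i1 i2 ⊢
      generalize m * (2 * (n : ℤ)) = x at *
      omega
    · rw [h] at i1 i2 ⊢
      simp only [tubePos, ho] at i1 i2 ⊢
      rw [show m * (2 * (n : ℤ)) = 2 * (m * n) by ring] at *
      generalize m * (n : ℤ) = x at *
      push_cast at *
      omega
  rcases hcases with h | h | h
  · exact absurd (eq_of_ring_eq_of_tubePos_eq hring (tubePos_eq_of_add h)) huv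
  · have h' : (tubePos u : ℝ) = tubePos v + m * (2 * n) + u.1.step := by exact_mod_cast h
    have e1 := hs (by linarith)
    have e2 := he' (by linarith)
    rw [hz] at e1
    have : u = tubeNext v := tubePoint_injective (by rw [← e1, ← e2, hz])
    refine ⟨u, by simp, by simp [← this], ?_⟩
    rw [hz, e1]
  · have h' : (tubePos v : ℝ) + m * (2 * n) = tubePos u + u.1.step := by exact_mod_cast h
    have e1 := he (by linarith)
    have e2 := hs' (by linarith)
    have : v = tubeNext u := tubePoint_injective (by rw [← e1, ← e2])
    exact ⟨v, by simp [← this], by simp, by rw [e2]⟩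

/-- The angle of a radial edge is never strictly inside that of a chord it could meet. The common
point is thus an end of the chord, lies on the circle, and is an end of the radial edge. -/
theorem next_inter_crossing [NeZero n] (hn : 3 ≤ n) {u v : TubeKind × ZMod n}
    (hv : v.1 = a ∨ v.1 = c ∨ v.1 = e ∨ v.1 = g) {z : ℂ}
    (hzu : z ∈ edgeSegment tubePoint s(u, tubeNext u))
    (hzv : z ∈ edgeSegment tubePoint s(v, tubeNeighbor v 0)) :
    ∃ t, t ∈ s(u, tubeNext u) ∧ t ∈ s(v, tubeNeighbor v 0) ∧ tubePoint t = z := by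
  obtain ⟨ρ, t, hz, ht1, ht2, hρ1, hρ2, hs, he⟩ := exists_polar_next hn hzu
  obtain ⟨ρ', hz', hρ1', hρ2'⟩ := exists_polar_crossing hv hzv
  have p1 := pow_three_pos u.1.ring
  have p2 := pow_three_pos v.1.ring
  obtain ⟨rfl, m, hm⟩ := eq_of_mul_unitPoint_eq (by linarith) (by linarith) (hz.symm.trans hz')
  have r1 : v.1.ring ≤ u.1.ring := by
    have := hρ1'.trans hρ2
    rwa [pow_le_pow_iff_right₀ (by norm_num)] at this
  have r2 : u.1.ring ≤ v.1.ring + 1 := ring_le_of_half_pow_le (hρ1.trans hρ2')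
  have hpar : u.1.step = 1 ∨ u.1.step = 2 ∧ u.1.offset = v.1.offset := by
    revert r1 r2 hv
    cases u.1 <;> cases v.1 <;> decide
  have i1 : (tubePos u : ℤ) ≤ tubePos v + m * (2 * n) := by
    have : (tubePos u : ℝ) ≤ tubePos v + m * (2 * n) := by linarith
    exact_mod_cast this
  have i2 : (tubePos v : ℤ) + m * (2 * n) ≤ tubePos u + u.1.step := by
    have : (tubePos v : ℝ) + m * (2 * n) ≤ tubePos u + u.1.step := by linarith
    exact_mod_cast this
  have hcases : (tubePos v : ℤ) + m * (2 * n) = tubePos u ∨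
      (tubePos v : ℤ) + m * (2 * n) = tubePos u + u.1.step := by
    rcases hpar with h | ⟨h, ho⟩
    · rw [h] at i2 ⊢
      generalize m * (2 * (n : ℤ)) = x at *
      omega
    · rw [h] at i2 ⊢
      simp only [tubePos, ho] at i1 i2 ⊢
      rw [show m * (2 * (n : ℤ)) = 2 * (m * n) by ring] at *
      generalize m * (n : ℤ) = x at *
      push_cast at *
      omega
  obtain ⟨x, hx, hxr, hzx⟩ : ∃ x, x ∈ s(u, tubeNext u) ∧ x.1.ring = u.1.ring ∧
      z = tubePoint x := by
    rcases hcases with h | h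
    · have h' : (tubePos v : ℝ) + m * (2 * n) = tubePos u := by exact_mod_cast h
      exact ⟨u, by simp, rfl, hs (by linarith)⟩
    · have h' : (tubePos v : ℝ) + m * (2 * n) = tubePos u + u.1.step := by exact_mod_cast h
      refine ⟨tubeNext u, by simp, ?_, he (by linarith)⟩
      obtain ⟨κ, i⟩ := u
      cases κ <;> rfl
  have hρ : ρ = 3 ^ u.1.ring := by
    have := (eq_of_mul_unitPoint_eq (by linarith) (pow_three_pos _) (hz.symm.trans hzx)).1
    rw [this, hxr]
  refine ⟨x, hx, ?_, hzx.symm⟩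
  rcases (by omega : u.1.ring = v.1.ring ∨ u.1.ring = v.1.ring + 1) with h | h
  · have : x = v := tubePoint_injective (by rw [← hzx, hz', hρ, h]; rfl)
    simp [this]
  · have : x = tubeNeighbor v 0 :=
      tubePoint_injective (by rw [← hzx, hz', hρ, h, tubePoint_tubeNeighbor_zero hv])
    simp [this]

/-- Radial edges of consecutive layers have offsets of different parity, so those at the same angle
and with overlapping radii coincide. -/
theorem eq_of_crossing_inter_crossing [NeZero n] {u v : TubeKind × ZMod n}
    (hu : u.1 = a ∨ u.1 = c ∨ u.1 = e ∨ u.1 = g) (hv : v.1 = a ∨ v.1 = c ∨ v.1 = e ∨ v.1 = g)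
    {z : ℂ} (hzu : z ∈ edgeSegment tubePoint s(u, tubeNeighbor u 0))
    (hzv : z ∈ edgeSegment tubePoint s(v, tubeNeighbor v 0)) : u = v := by
  obtain ⟨ρ, hz, hρ1, hρ2⟩ := exists_polar_crossing hu hzu
  obtain ⟨ρ', hz', hρ1', hρ2'⟩ := exists_polar_crossing hv hzv
  have p1 := pow_three_pos u.1.ring
  have p2 := pow_three_pos v.1.ring
  obtain ⟨rfl, m, hm⟩ := eq_of_mul_unitPoint_eq (by linarith) (by linarith) (hz.symm.trans hz')
  have hpos : tubePos u = tubePos v := tubePos_eq_of_add (m := m) (by exact_mod_cast hm)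
  have r1 := hρ1.trans hρ2'
  have r2 := hρ1'.trans hρ2
  rw [pow_le_pow_iff_right₀ (by norm_num)] at r1 r2
  refine eq_of_ring_eq_of_tubePos_eq ?_ hpos
  have ho : u.1.offset % 2 = v.1.offset % 2 := by
    unfold tubePos at hpos
    omega
  revert hu hv r1 r2 ho
  cases u.1 <;> cases v.1 <;> decide

theorem isStraightDrawing_tubeGraph [NeZero n] (hn : 3 ≤ n) :
    IsStraightDrawing (tubeGraph n) tubePoint where
  inj := tubePoint_injective
  inter := by
    intro s hs s' hs' hne z hz hz'
    rcases tube_edge_cases hs with ⟨u, rfl⟩ | ⟨u, hu, rfl⟩ <;>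
      rcases tube_edge_cases hs' with ⟨v, rfl⟩ | ⟨v, hv, rfl⟩
    · exact next_inter_next hn (fun h => hne (by rw [h])) hz hz'
    · exact next_inter_crossing hn hv hz hz'
    · obtain ⟨t, h1, h2, h3⟩ := next_inter_crossing hn hu hz' hz
      exact ⟨t, h2, h1, h3⟩
    · exact absurd (eq_of_crossing_inter_crossing hu hv hz hz') fun h => hne (by rw [h])

end TubeDrawing

/-! ### Assembling the counterexamples. -/

theorem truncationPlan_tubeGraph {n p : ℕ} [NeZero n] (hp : 1 ≤ p) (hpn : 2 * p + 6 ≤ n) :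
    TruncationPlan (2 * p + 3) (2 * (4 * p + 11)) (tubeGraph n) id (tubeDemand p)
      fun _ => p + 1 where
  threeConnected := isThreeConnected_tubeGraph (by omega)
  drawing := ⟨tubePoint, isStraightDrawing_tubeGraph (by omega)⟩
  surjective := Function.surjective_id
  fibre_le := by
    intro v
    refine le_of_eq_of_le (Finset.sum_eq_single v (fun x _ hx => if_neg hx)
      fun h => absurd (Finset.mem_univ v) h) ?_
    rw [if_pos (id_eq v)]
    omega
  heavy := by
    intro C hC hev
    by_cases h : ∃ u v, C.Adj u v
    · obtain ⟨u, v, huv⟩ := h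
      have := heavy_tubeGraph (by omega) hp hpn hC hev huv
      left
      omega
    · push Not at h
      exact Or.inr fun u v huv => absurd huv (h u v)
  demand := fun v => Or.inr (tube_isSplitDemand (by omega) hp v)

theorem exists_isCounterexample_of_card {k : ℕ} (hk : 6 ≤ k) (hk_even : Even k) (N : ℕ) :
    ∃ (V : Type) (_ : Fintype V) (G : SimpleGraph V),
      N ≤ Fintype.card V ∧ IsCounterexample k G := by
  obtain ⟨m, rfl⟩ := hk_even
  -- With k = 2p + 4 the fibre bound 2p + 3 is k - 1 and 4p + 11 is 2k + 3; evenness enters because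
  -- fibres have odd size.
  obtain ⟨p, rfl⟩ : ∃ p, m = p + 2 := ⟨m - 2, by omega⟩
  set n := 2 * p + 6 + N with hn
  have : NeZero n := ⟨by omega⟩
  have : Nontrivial (TubeKind × ZMod n) :=
    ⟨(TubeKind.a, 0), (TubeKind.b, 0), fun h => by simpa using congrArg Prod.fst h⟩
  have hplan := truncationPlan_tubeGraph (n := n) (p := p) (by omega) (by omega)
  obtain ⟨V, _, G, π, y, hG⟩ := hplan.exists_complete _ _ _ _ _ _ rfl
  refine ⟨V, inferInstance, G, ?_, TruncationPlan.isCounterexample (π := π) (y := y) (by omega) ?_⟩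
  · have := Fintype.card_le_of_surjective π hG.surjective
    rw [Fintype.card_prod, ZMod.card, TubeKind.card] at this
    omega
  · convert hG using 1 <;> omega

section Iso

variable {V W : Type} {G : SimpleGraph V} {G' : SimpleGraph W}

theorem cycleSpectrum_subset_of_iso (φ : G ≃g G') : cycleSpectrum G ⊆ cycleSpectrum G' := by
  rintro _ ⟨v, c, hc, rfl⟩
  exact ⟨φ v, c.map φ.toHom, hc.map φ.injective, by simp⟩

theorem isPlanar_of_iso (φ : G ≃g G') (h : IsPlanar G) : IsPlanar G' := by
  obtain ⟨P⟩ := h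
  have hedge : ∀ s ∈ G'.edgeSet, s.map φ.symm ∈ G.edgeSet := by
    intro s
    induction s using Sym2.ind with
    | _ x z => exact fun h => φ.symm.map_adj_iff.2 h
  refine ⟨⟨P.point ∘ φ.symm, fun s => P.arc (s.map φ.symm),
    P.point_injective.comp φ.symm.injective, fun u v huv => ?_, fun s hs w hw => ?_,
    fun s hs t ht hst => ?_⟩⟩
  · exact P.isArc _ _ (φ.symm.map_adj_iff.2 huv)
  · obtain ⟨x, hx, hxw⟩ := Sym2.mem_map.1 (P.mem_of_point_mem _ (hedge s hs) _ hw)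
    rwa [← φ.symm.injective hxw]
  · intro q hq
    obtain ⟨v, ⟨h1, h2⟩, rfl⟩ := P.arc_inter _ (hedge s hs) _ (hedge t ht)
      (fun h => hst (Sym2.map.injective φ.symm.injective h)) hq
    obtain ⟨x, hx, rfl⟩ := Sym2.mem_map.1 h1
    obtain ⟨x', hx', hxx'⟩ := Sym2.mem_map.1 h2
    rw [φ.symm.injective hxx'] at hx'
    exact ⟨x, ⟨hx, hx'⟩, rfl⟩

theorem isCubic_of_iso [Fintype V] [Fintype W] (φ : G ≃g G') (h : IsCubic G) : IsCubic G' := by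
  classical
  intro w
  have h1 := h (φ.symm w)
  have h2 := φ.symm.degree_eq w
  convert h2.symm.trans (Eq.trans (by congr) h1) using 1

theorem isThreeConnected_of_iso [Fintype V] [Fintype W] (φ : G ≃g G')
    (h : IsThreeConnected G) : IsThreeConnected G' := by
  classical
  refine ⟨(Fintype.card_congr φ.toEquiv) ▸ h.1, fun S hS => ?_⟩
  set S₀ := S.map φ.symm.toEquiv.toEmbedding with hS₀
  have hmem : ∀ x, x ∈ S₀ ↔ φ x ∈ S := by
    intro x
    rw [hS₀, Finset.mem_map_equiv]
    rfl
  have hconn := h.2 S₀ (by rwa [hS₀, Finset.card_map])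
  have hlink : ∀ x z, x ∉ S₀ → z ∉ S₀ → Linked G' S (φ x) (φ z) := fun x z hx hz =>
    (Linked.of_connected hconn hx hz).induction (P := fun x z => Linked G' S (φ x) (φ z))
      (fun x hx => .refl fun h => hx ((hmem x).2 h))
      fun x y z hx hy hxy hyz => .trans (.of_adj (φ.map_adj_iff.2 hxy)
        (fun h => hx ((hmem x).2 h)) (fun h => hy ((hmem y).2 h))) hyz
  obtain ⟨⟨x, hx⟩⟩ := hconn.nonempty
  have hx : x ∉ S₀ := by simpa using hx
  refine Linked.connected (b := φ x) (fun h => hx ((hmem x).2 h)) fun w hw => ?_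
  have := hlink (φ.symm w) x (by rw [hmem]; simpa using hw) hx
  simpa using this

theorem IsCounterexample.of_iso [Fintype V] [Fintype W] {k : ℕ} (φ : G ≃g G')
    (h : IsCounterexample k G) : IsCounterexample k G' := by
  obtain ⟨h1, h2, h3, h4, h5⟩ := h
  have hspec : cycleSpectrum G = cycleSpectrum G' :=
    (cycleSpectrum_subset_of_iso φ).antisymm (cycleSpectrum_subset_of_iso φ.symm)
  refine ⟨isThreeConnected_of_iso φ h1, isCubic_of_iso φ h2, isPlanar_of_iso φ h3, ?_, ?_⟩
  · unfold circumference at h4 ⊢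
    rwa [← hspec]
  · rwa [← hspec]

end Iso

theorem exists_isCounterexample_fin {k : ℕ} (hk : 6 ≤ k) (hk_even : Even k) (N : ℕ) :
    ∃ n, N ≤ n ∧ ∃ G : SimpleGraph (Fin n), IsCounterexample k G := by
  obtain ⟨V, _, G, hN, hG⟩ := exists_isCounterexample_of_card hk hk_even N
  exact ⟨_, hN, _, hG.of_iso (SimpleGraph.Iso.map (Fintype.equivFin V) G)⟩

theorem mainTheorem1 (k : ℕ) (hk : 6 ≤ k) (hk_even : Even k) :
    (∃ (n : ℕ → ℕ) (G : ∀ i : ℕ, SimpleGraph (Fin (n i))),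
      (∀ i j : ℕ, i ≠ j → IsEmpty (G i ≃g G j)) ∧
      ∀ i : ℕ, IsThreeConnected (G i) ∧ IsCubic (G i) ∧ IsPlanar (G i) ∧
        (k : ℕ∞) ≤ circumference (G i) ∧
        cycleSpectrum (G i) ∩ Set.Icc k (2 * k + 2) = ∅) ∧
    ¬ MerkerConjecture k := by
  -- Counterexamples exist of infinitely many orders; one for each order gives graphs that are
  -- pairwise non-isomorphic by counting vertices.
  have hinf : {n | ∃ G : SimpleGraph (Fin n), IsCounterexample k G}.Infinite := by
    rw [Set.infinite_iff_exists_gt]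
    intro N
    obtain ⟨n, hn, hG⟩ := exists_isCounterexample_fin hk hk_even (N + 1)
    exact ⟨n, hG, hn⟩
  set n : ℕ → ℕ := Nat.nth fun n => ∃ G : SimpleGraph (Fin n), IsCounterexample k G with hn
  have hG : ∀ i, ∃ G : SimpleGraph (Fin (n i)), IsCounterexample k G := Nat.nth_mem_of_infinite hinf
  choose G hG using hG
  refine ⟨⟨n, G, fun i j hij => ⟨fun φ => hij ?_⟩, hG⟩, fun hM => ?_⟩
  · have h := Fintype.card_congr φ.toEquiv
    rw [Fintype.card_fin, Fintype.card_fin] at h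
    exact Nat.nth_injective hinf h
  · obtain ⟨h1, h2, h3, h4, h5⟩ := hG 0
    have := hM _ (G 0) h1 h2 h3 h4
    rw [h5] at this
    exact Set.not_nonempty_empty this
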